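/- Let $\mathbb F$ be a finite field of size $q\equiv 3 \pmod 4$, let $n=2m$ with $m>1$ odd, and let $\mathrm{GL}(n,\mathbb F)$ act on the right on the space $V=\mathbb F^n$ of row vectors. A subgroup $H\le \mathrm{GL}(n,\mathbb F)$ is irreducible if $0$ and $V\neq 0$ are its only invariant subspaces. A system of imprimitivity of size $k>1$ for $H$ is a set of $k$ nonzero subspaces $V_1,\dots,V_k$ of $V$, permuted by $H$, with $V=V_1\oplus\cdots\oplus V_k$. $H$ is primitive if it is irreducible and has no system of imprimitivity. The same definitions apply in every degree. Let $G=G_2\times C$ (internal direct product) be a subgroup of $\mathrm{GL}(n,\mathbb F)$, where $C=\langle c\rangle$ is cyclic of odd order and $G_2$ is a generalised quaternion (of order $\ge 8$, so $Q_8$ is allowed), dihedral (of order $\ge 8$) or semidihedral (of order $\ge 16$) $2$-group. Let $a,g$ be such that $G_2=\langle a,g\rangle$, $|G_2:\langle a\rangle|=2$ and $|a|\ge 4$, and suppose that $A=\langle c,a\rangle$ is irreducible. Then $G$ is primitive and $A$ is not primitive if and only if all of the following hold: (1) $A$ has a system of imprimitivity of size $2$; (2) $C$ is conjugate in $\mathrm{GL}(n,\mathbb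 F)$ to $\langle (x,x)\rangle$ for some $x\in\mathrm{GL}(m,\mathbb F)$ such that $\langle x\rangle$ is a primitive subgroup of $\mathrm{GL}(m,\mathbb F)$, where $(x,x)$ denotes the block diagonal matrix with two diagonal blocks $x$; (3) $a^2=g^2=[a,g]=-1_n$. Moreover, (3) implies $G_2\cong Q_8$. -/

import Mathlib

namespace LinGroup

/-- The right action of an invertible matrix `h` on subspaces of the space of row vectors:
`W ↦ W h`. -/
def translate {F : Type*} [Field F] {n : ℕ} (W : Submodule F (Fin n → F))
    (h : GL (Fin n) F) : Submodule F (Fin n → F) :=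
  W.map (Matrix.vecMulLinear (h : Matrix (Fin n) (Fin n) F))

/-- `H ≤ GL(n, F)` is irreducible: the row space `V = F^n` is nonzero, and its only
`H`-invariant subspaces are `0` and `V`. -/
def IsIrreducible {F : Type*} [Field F] {n : ℕ} (H : Subgroup (GL (Fin n) F)) : Prop :=
  0 < n ∧ ∀ W : Submodule F (Fin n → F), (∀ h ∈ H, translate W h ≤ W) → W = ⊥ ∨ W = ⊤

/-- `V 0, …, V (k-1)` is a system of imprimitivity, of size `k > 1`, for `H ≤ GL(n, F)`: the
`V i` are nonzero subspaces whose direct sum is `F^n`, and `H` permutes them. -/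
def IsImprimitivitySystem {F : Type*} [Field F] {n k : ℕ} (H : Subgroup (GL (Fin n) F))
    (V : Fin k → Submodule F (Fin n → F)) : Prop :=
  1 < k ∧ (∀ i, V i ≠ ⊥) ∧ DirectSum.IsInternal V ∧
    ∀ h ∈ H, ∀ i, ∃ j, translate (V i) h = V j

/-- `H` has a system of imprimitivity of size `k`. -/
def HasImprimitivitySystem {F : Type*} [Field F] {n : ℕ} (H : Subgroup (GL (Fin n) F))
    (k : ℕ) : Prop :=
  ∃ V : Fin k → Submodule F (Fin n → F), IsImprimitivitySystem H V

/-- `H` is primitive: irreducible, without systems of imprimitivity. -/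
def IsPrimitive {F : Type*} [Field F] {n : ℕ} (H : Subgroup (GL (Fin n) F)) : Prop :=
  IsIrreducible H ∧ ∀ k : ℕ, ¬ HasImprimitivitySystem H k

/-- The block diagonal matrix `(x, x)` of degree `2m`, for `x ∈ GL(m, F)`. -/
def diagPair {F : Type*} [Field F] {m : ℕ} (x : GL (Fin m) F) : GL (Fin (2 * m)) F where
  val := Matrix.reindexAlgEquiv F F (finSumFinEquiv.trans (finCongr (two_mul m).symm))
    (Matrix.fromBlocks (x : Matrix (Fin m) (Fin m) F) 0 0 (x : Matrix (Fin m) (Fin m) F))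
  inv := Matrix.reindexAlgEquiv F F (finSumFinEquiv.trans (finCongr (two_mul m).symm))
    (Matrix.fromBlocks ((x⁻¹ : GL (Fin m) F) : Matrix (Fin m) (Fin m) F) 0 0
      ((x⁻¹ : GL (Fin m) F) : Matrix (Fin m) (Fin m) F))
  val_inv := by
    rw [← map_mul, Matrix.fromBlocks_multiply, ← Units.val_mul, mul_inv_cancel]
    simp only [Units.val_one, mul_zero, zero_mul, add_zero, zero_add, Matrix.fromBlocks_one, map_one]
  inv_val := by
    rw [← map_mul, Matrix.fromBlocks_multiply, ← Units.val_mul, inv_mul_cancel]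
    simp only [Units.val_one, mul_zero, zero_mul, add_zero, zero_add, Matrix.fromBlocks_one, map_one]

/-- Conjugacy of subgroups. -/
def AreConjugate {Γ : Type*} [Group Γ] (H K : Subgroup Γ) : Prop :=
  ∃ t : Γ, H.map (MulAut.conj t).toMonoidHom = K

/-- `H` is a dihedral group of order `2^(k+1) ≥ 8`. -/
def IsDihedralTwoGroup (H : Type*) [Group H] : Prop :=
  ∃ k : ℕ, 2 ≤ k ∧ Nonempty (H ≃* DihedralGroup (2 ^ k))

/-- `H` is a (generalised) quaternion group of order `2^(k+2) ≥ 8`; this includes `Q₈`. -/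
def IsGenQuaternionTwoGroup (H : Type*) [Group H] : Prop :=
  ∃ k : ℕ, 1 ≤ k ∧ Nonempty (H ≃* QuaternionGroup (2 ^ k))

/-- `H` is the semidihedral group of order `2^(k+1) ≥ 16`, i.e.
`⟨x, y | x^(2^k) = y^2 = 1, y x y⁻¹ = x^(2^(k-1) - 1)⟩`. -/
def IsSemidihedralTwoGroup (H : Type*) [Group H] : Prop :=
  ∃ k : ℕ, 3 ≤ k ∧ ∃ x y : H, orderOf x = 2 ^ k ∧ orderOf y = 2 ∧
    y * x * y⁻¹ = x ^ (2 ^ (k - 1) - 1) ∧ Nat.card H = 2 ^ (k + 1) ∧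
    Subgroup.closure {x, y} = ⊤

end LinGroup

namespace LinGroup

open Module

/-! By Schur's lemma the endomorphisms commuting with `a` and `c` form a finite field, of degree
`2m` over `F`. As `m` is odd and `q ≡ 3 mod 4`, its elements of 2-power order lie in `F(i)`, where
`i² = -1`. So `a = α + βi` with `β ≠ 0`, `g` anticommutes with `i`, and `g²`, which lies in `F(i)`
and commutes with `g`, is `±1`. The algebra `F[c]` has dimension exactly `m`: `V = F[c]v + F[c]iv`
for `v ≠ 0`, while dimension `2m` would make the centraliser of `c` commutative, although it
contains `i` and `g`.

Everything then depends on the numbers `d_j = dim F[c^j]` (`powDim`) and on the condition (*): no `j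
> 1` satisfies `j * d_j ∣ m`. If (*) fails, `G` is imprimitive (`exists_system`): some `(x + yi)g`
is an involution, an eigenvector `v` of it spans with `iv` a plane invariant under `a` and `g`, and
the `c`-translates of the `F[c^j]`-module generated by this plane form a system of size `j`. If (*)
holds, an orbit count (`exists_orbit_length`) shows that every system permuted by `c` consists of
two `c`-invariant subspaces of dimension `m` (`two_blocks`). Moreover (*) is equivalent to (2)
(`exists_conjugate_diagPair`, `not_dvd_of_conjugate_diagPair`), because `V` is a plane over the
field `F[c]`.

Given (*), the rest is parity: as `-1` is not a square in `F`, an operator with square `-1` has no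
invariant subspace of odd dimension. Hence a system for `A` forces `a² = -1` and `ga = -ag`
(`relations_of_two_blocks`), and `g² = 1` would make the eigenspaces of `g` a system for `G`
(`exists_system_of_involution`). Conversely, under (3) one of `a`, `g`, `ag` would preserve a block
of odd dimension, while all three have square `-1` (`not_permutes`). -/

/-- `f` permutes the members of the family `V`. -/
def Permutes {F X ι : Type*} [Field F] [AddCommGroup X] [Module F X]
    (V : ι → Submodule F X) (f : End F X) : Prop :=
  ∀ i, ∃ j, (V i).map f = V j

/-! ### Invariant subspaces, translates and orbits of blocks. -/

section LinearAlgebra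

variable {F X : Type*} [Field F] [AddCommGroup X] [Module F X]

lemma map_pow_succ (W : Submodule F X) (f : End F X) (k : ℕ) :
    (W.map (f ^ k)).map f = W.map (f ^ (k + 1)) := by
  rw [← Submodule.map_comp, pow_succ', Module.End.mul_eq_comp]

lemma map_map_of_commute {f h : End F X} (hc : Commute f h) (W : Submodule F X) :
    (W.map f).map h = (W.map h).map f := by
  rw [← Submodule.map_comp, ← Submodule.map_comp, ← Module.End.mul_eq_comp,
    ← Module.End.mul_eq_comp, hc.eq]

lemma map_pow_le {W : Submodule F X} {f : End F X} (h : W.map f ≤ W) (k : ℕ) :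
    W.map (f ^ k) ≤ W := by
  induction k with
  | zero => simp [Module.End.one_eq_id]
  | succ k ih => exact (map_pow_succ W f k) ▸ (Submodule.map_mono ih).trans h

lemma map_eq_of_injective [FiniteDimensional F X] {W : Submodule F X} {f : End F X}
    (hf : Function.Injective f) (h : W.map f ≤ W) : W.map f = W :=
  Submodule.eq_of_le_of_finrank_eq h (LinearEquiv.finrank_eq (Submodule.equivMapOfInjective f hf W)).symm

/-- A subspace invariant under `f` is invariant under the algebra generated by `f`. -/
lemma map_le_of_mem_adjoin {W : Submodule F X} {f T : End F X} (h : W.map f ≤ W)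
    (hT : T ∈ Algebra.adjoin F {f}) : W.map T ≤ W := by
  rw [Submodule.map_le_iff_le_comap] at *
  induction hT using Algebra.adjoin_induction with
  | mem x hx => rwa [Set.mem_singleton_iff.1 hx]
  | algebraMap r => exact fun w hw => by simpa using W.smul_mem r hw
  | add x y _ _ hx hy => exact fun w hw => W.add_mem (hx hw) (hy hw)
  | mul x y _ _ hx hy => exact fun w hw => hx (hy hw)

/-- If an algebra of endomorphisms is a field, its dimension divides that of every
invariant subspace. -/
lemma finrank_dvd_of_isField (S : Subalgebra F (End F X)) (hS : IsField S) (W : Submodule F X)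
    (hW : ∀ T ∈ S, W.map T ≤ W) : finrank F S ∣ finrank F W := by
  let : Field S := hS.toField
  -- `W` is a vector space over the field `S`, so the tower law applies.
  let W' : Submodule S X :=
    { W with smul_mem' := fun T w hw => hW T T.2 (Submodule.mem_map_of_mem hw) }
  have h := Module.finrank_mul_finrank F S W'
  exact ⟨_, h.symm⟩

lemma finrank_iSup_of_iSupIndep {ι : Type*} [Fintype ι] [FiniteDimensional F X]
    {V : ι → Submodule F X} (hV : iSupIndep V) :
    finrank F (⨆ i, V i : Submodule F X) = ∑ i, finrank F (V i) := by
  classical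
  rw [Submodule.iSup_eq_range_dfinsupp_lsum,
    LinearMap.finrank_range_of_inj hV.dfinsupp_lsum_injective]
  exact Module.finrank_directSum (R := F) (M := fun i => V i)

/-- The external direct sum maps onto the space and is no larger, so the map is bijective. Thanks to
this, only upper bounds for dimensions of blocks are needed later. -/
lemma isInternal_of_sum_finrank_le {ι : Type*} [Fintype ι] [DecidableEq ι] [FiniteDimensional F X]
    {V : ι → Submodule F X} (htop : ⨆ i, V i = ⊤) (h : ∑ i, finrank F (V i) ≤ finrank F X) :
    DirectSum.IsInternal V := by
  have hsurj : Function.Surjective (DirectSum.coeLinearMap V) := by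
    rw [← LinearMap.range_eq_top, DirectSum.range_coeLinearMap, htop]
  have heq : finrank F (DirectSum ι fun i => V i) = finrank F X := by
    apply le_antisymm
    · rw [Module.finrank_directSum]; exact h
    · exact LinearMap.finrank_le_finrank_of_surjective hsurj
  exact ⟨(LinearMap.injective_iff_surjective_of_finrank_eq_finrank heq).2 hsurj, hsurj⟩

/-- The translates of a subspace by the powers of `f` form a direct decomposition when their
dimensions allow it. -/
lemma isInternal_translates [FiniteDimensional F X] {f : End F X} {W : Submodule F X} {j : ℕ}
    (htop : ⨆ i : Fin j, W.map (f ^ (i : ℕ)) = ⊤) (hdim : j * finrank F W ≤ finrank F X) :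
    DirectSum.IsInternal fun i : Fin j => W.map (f ^ (i : ℕ)) := by
  refine isInternal_of_sum_finrank_le htop (le_trans ?_ hdim)
  calc ∑ i : Fin j, finrank F (W.map (f ^ (i : ℕ)))
      ≤ ∑ i : Fin j, finrank F W := Finset.sum_le_sum fun i _ => Submodule.finrank_map_le _ _
    _ = j * finrank F W := by simp

lemma permutes_translates [FiniteDimensional F X] {f : End F X} (hf : Function.Injective f)
    {W : Submodule F X} {j : ℕ} (hW : W.map (f ^ j) ≤ W) :
    Permutes (fun i : Fin j => W.map (f ^ (i : ℕ))) f := by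
  intro i
  by_cases h : (i : ℕ) + 1 < j
  · exact ⟨⟨i + 1, h⟩, map_pow_succ _ _ _⟩
  · have hj : (i : ℕ) + 1 = j := by have := i.2; omega
    refine ⟨⟨0, by omega⟩, ?_⟩
    have hinj : Function.Injective (f ^ j : End F X) := by
      rw [Module.End.coe_pow]; exact hf.iterate j
    simp only [map_pow_succ, hj, pow_zero, Module.End.one_eq_id, Submodule.map_id]
    exact map_eq_of_injective hinj hW

lemma permutes_translates_of_commute [FiniteDimensional F X] {f h : End F X}
    (hh : Function.Injective h) (hc : Commute f h) {W : Submodule F X} {j : ℕ}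
    (hW : W.map h ≤ W) : Permutes (fun i : Fin j => W.map (f ^ (i : ℕ))) h := by
  intro i
  refine ⟨i, ?_⟩
  simp only
  rw [map_map_of_commute (hc.pow_left _), map_eq_of_injective hh hW]

lemma iSup_translates_map_le [FiniteDimensional F X] {f : End F X} (hf : Function.Injective f)
    {W : Submodule F X} {j : ℕ} (hW : W.map (f ^ j) ≤ W) :
    (⨆ i : Fin j, W.map (f ^ (i : ℕ))).map f ≤ ⨆ i : Fin j, W.map (f ^ (i : ℕ)) := by
  rw [Submodule.map_iSup, iSup_le_iff]
  intro i
  obtain ⟨k, hk⟩ := permutes_translates hf hW i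
  exact hk.trans_le (le_iSup (fun i : Fin j => W.map (f ^ (i : ℕ))) k)

lemma injective_of_pow_eq_one {f : End F X} {N : ℕ} (hN : 0 < N) (h : f ^ N = 1) :
    Function.Injective f := by
  obtain ⟨n, rfl⟩ : ∃ n, N = n + 1 := ⟨N - 1, by omega⟩
  intro x y hxy
  have hx : ∀ z, (f ^ n) (f z) = z := fun z => by
    rw [← Module.End.mul_apply, ← pow_succ, h]; rfl
  rw [← hx x, ← hx y, hxy]

/-- The orbit of a member of a direct decomposition under an endomorphism `f` of odd order which
permutes the members: the stabiliser `⟨f ^ j⟩` acts on that member, and the dimension `d j` of the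
algebra it generates satisfies `j * d j ∣ m`. -/
lemma exists_orbit_length [FiniteDimensional F X] {ι : Type*} [Fintype ι] [DecidableEq ι]
    {V : ι → Submodule F X} (hV : DirectSum.IsInternal V) (hne : ∀ i, V i ≠ ⊥)
    {f : End F X} {N : ℕ} (hN : Odd N) (hf : f ^ N = 1) (hperm : Permutes V f)
    {m r : ℕ} (hm : 0 < m) (hr : r = 1 ∨ r = 2) (hX : finrank F X = r * m) {d : ℕ → ℕ}
    (hodd : ∀ j, Odd (d j))
    (hd : ∀ j (W : Submodule F X), W.map (f ^ j) ≤ W → d j ∣ finrank F W) (hd1 : d 1 = m) (i : ι) :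
    ∃ j, 0 < j ∧ j * d j ∣ m ∧ (j = 1 → (V i).map f ≤ V i) := by
  choose σ hσ using hperm
  have hinj := injective_of_pow_eq_one hN.pos hf
  have hind := hV.submodule_iSupIndep
  have hVinj := hind.injective hne
  have hiter : ∀ n, (V i).map (f ^ n) = V (σ^[n] i) := by
    intro n
    induction n with
    | zero => simp [Module.End.one_eq_id]
    | succ n ih => rw [← map_pow_succ, ih, hσ, Function.iterate_succ_apply']
  have hfpow : ∀ n, Function.Injective (f ^ n : End F X) := fun n => by
    rw [Module.End.coe_pow]; exact hinj.iterate n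
  have hper : Function.IsPeriodicPt σ N i := by
    apply hVinj
    rw [← hiter, hf, Module.End.one_eq_id, Submodule.map_id]
  set j := Function.minimalPeriod σ i with hj
  have hjN : j ∣ N := hper.minimalPeriod_dvd
  have hjodd : Odd j := hN.of_dvd_nat hjN
  have hjV : (V i).map (f ^ j) = V i := by rw [hiter, hj, Function.iterate_minimalPeriod]
  refine ⟨j, hjodd.pos, ?_, fun h => ?_⟩
  · let Y : Fin j → Submodule F X := fun n => (V i).map (f ^ (n : ℕ))
    have hYV : Y = V ∘ fun n : Fin j => σ^[(n : ℕ)] i := funext fun n => hiter n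
    have hYind : iSupIndep Y := by
      rw [hYV]
      apply hind.comp
      intro n n' hn
      exact Fin.ext (Function.iterate_injOn_Iio_minimalPeriod n.2 n'.2 hn)
    have hYdim : finrank F (⨆ n, Y n : Submodule F X) = j * finrank F (V i) := by
      rw [finrank_iSup_of_iSupIndep hYind]
      have : ∀ n, finrank F (Y n) = finrank F (V i) := fun n =>
        (LinearEquiv.finrank_eq (Submodule.equivMapOfInjective _ (hfpow n) (V i))).symm
      simp [this]
    have hYf : (⨆ n, Y n : Submodule F X).map (f ^ 1) ≤ ⨆ n, Y n := by
      rw [pow_one]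
      exact iSup_translates_map_le hinj hjV.le
    have h1 := hd 1 _ hYf
    rw [hd1, hYdim] at h1
    obtain ⟨t, ht⟩ := h1
    have hpos : 0 < finrank F (V i) := by
      rw [Nat.pos_iff_ne_zero, ne_eq, Submodule.finrank_eq_zero]; exact hne i
    have hle : j * finrank F (V i) ≤ r * m := by
      rw [← hYdim, ← hX]; exact Submodule.finrank_le _
    -- The span of the orbit is `f`-invariant, so its dimension is a multiple `m * t`, and it is at
    -- most `r * m`.
    have ht2 : t = 1 ∨ t = 2 := by
      have : 0 < j * finrank F (V i) := Nat.mul_pos hjodd.pos hpos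
      have h0 : t ≠ 0 := by rintro rfl; rw [mul_zero] at ht; omega
      have h2 : t ≤ 2 := by
        rw [ht] at hle
        have : t * m ≤ 2 * m := by rcases hr with rfl | rfl <;> nlinarith
        exact Nat.le_of_mul_le_mul_right this hm
      omega
    have hdvd : j * d j ∣ m * t := ht ▸ Nat.mul_dvd_mul_left j (hd j _ hjV.le)
    -- Since `j * d j` is odd, the factor `t ≤ 2` can be dropped.
    refine Nat.Coprime.dvd_of_dvd_mul_right (?_ : Nat.Coprime (j * d j) t) hdvd
    rcases ht2 with rfl | rfl
    · simp
    · exact Nat.Coprime.symm (Nat.coprime_two_left.2 (hjodd.mul (hodd j)))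
  · rw [h, pow_one] at hjV
    exact hjV.le

/-- A square root of `-1` has no invariant subspace of odd dimension if `-1` is not a square. -/
lemma even_finrank_of_sq_eq_neg_one [FiniteDimensional F X] (hsq : ¬ IsSquare (-1 : F))
    {b : End F X} (hb : b * b = -1) {W : Submodule F X} (hW : W.map b ≤ W) :
    Even (finrank F W) := by
  rw [← Nat.not_odd_iff_even]
  intro hodd
  have hW' : ∀ w ∈ W, b w ∈ W := fun w hw => hW (Submodule.mem_map_of_mem hw)
  have h : b.restrict hW' * b.restrict hW' = (-1 : F) • 1 := by
    ext w
    have := LinearMap.congr_fun hb (w : X)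
    simpa using this
  -- The determinant of the restriction would be a square root of `(-1) ^ finrank F W = -1`.
  have h2 := congrArg LinearMap.det h
  rw [map_mul, LinearMap.det_smul, hodd.neg_one_pow, map_one, mul_one] at h2
  exact hsq ⟨_, h2.symm⟩

end LinearAlgebra

end LinGroup

namespace LinGroup

open Module

/-! ### Elements of 2-power order in finite fields. -/

section FiniteFields

lemma not_isSquare_neg_one {F : Type*} [Field F] [Finite F] (hq : Nat.card F % 4 = 3) :
    ¬ IsSquare (-1 : F) := by
  have := Fintype.ofFinite F
  rw [FiniteField.isSquare_neg_one_iff, ← Nat.card_eq_fintype_card]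
  omega

lemma two_ne_zero_of_card {F : Type*} [Field F] [Finite F] (hq : Nat.card F % 4 = 3) :
    (2 : F) ≠ 0 := by
  intro h
  apply not_isSquare_neg_one hq
  exact ⟨1, by linear_combination -h⟩

/-- A `2`-element of the multiplicative group of a field of order `q ≡ 3 mod 4` is `±1`. -/
lemma eq_one_or_neg_one_of_pow {F : Type*} [Field F] [Finite F] (hq : Nat.card F % 4 = 3)
    {x : F} {s : ℕ} (hx : x ^ 2 ^ s = 1) : x = 1 ∨ x = -1 := by
  have := Fintype.ofFinite F
  rw [Nat.card_eq_fintype_card] at hq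
  have hx0 : x ≠ 0 := by
    rintro rfl
    rw [zero_pow (by positivity)] at hx
    exact zero_ne_one hx
  have h1 := FiniteField.pow_card_sub_one_eq_one x hx0
  have h2 : orderOf x ∣ 2 ^ s := orderOf_dvd_of_pow_eq_one hx
  have h3 : orderOf x ∣ 2 * ((Fintype.card F - 1) / 2) := by
    rw [show 2 * ((Fintype.card F - 1) / 2) = Fintype.card F - 1 by omega]
    exact orderOf_dvd_of_pow_eq_one h1
  have hodd : Odd ((Fintype.card F - 1) / 2) := Nat.odd_iff.2 (by omega)
  have hcop : Nat.Coprime (orderOf x) ((Fintype.card F - 1) / 2) :=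
    Nat.Coprime.coprime_dvd_left h2 (Nat.Coprime.pow_left _ (Nat.coprime_two_left.2 hodd))
  have h4 : orderOf x ∣ 2 := hcop.dvd_of_dvd_mul_right h3
  have h5 : x ^ 2 = 1 := orderOf_dvd_iff_pow_eq_one.1 h4
  exact mul_self_eq_one_iff.1 (by rw [← sq]; exact h5)

/-- The `q` elements of `F` already exhaust the roots of `X ^ q - X`. -/
lemma mem_range_algebraMap_of_pow_card {F K : Type*} [Field F] [Fintype F] [Field K] [Algebra F K]
    {x : K} (hx : x ^ Fintype.card F = x) : ∃ r : F, algebraMap F K r = x := by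
  classical
  have hmap : (Finset.univ.image (algebraMap F K)) ⊆
      (Polynomial.X ^ Fintype.card F - Polynomial.X : Polynomial K).roots.toFinset := by
    intro y hy
    obtain ⟨r, -, rfl⟩ := Finset.mem_image.1 hy
    rw [Multiset.mem_toFinset, Polynomial.mem_roots
      (FiniteField.X_pow_card_sub_X_ne_zero K Fintype.one_lt_card)]
    simp [← map_pow, FiniteField.pow_card]
  have heq := Finset.eq_of_subset_of_card_le hmap (by
    rw [Finset.card_image_of_injective _ (algebraMap F K).injective, Finset.card_univ]
    refine (Multiset.toFinset_card_le _).trans ((Polynomial.card_roots' _).trans ?_)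
    rw [FiniteField.X_pow_card_sub_X_natDegree_eq K Fintype.one_lt_card])
  have hmem : x ∈ Finset.univ.image (algebraMap F K) := by
    rw [heq, Multiset.mem_toFinset, Polynomial.mem_roots
      (FiniteField.X_pow_card_sub_X_ne_zero K Fintype.one_lt_card)]
    simp [hx]
  obtain ⟨r, -, hr⟩ := Finset.mem_image.1 hmem
  exact ⟨r, hr⟩

/-- In an extension of degree `2m`, `m` odd, of a field of order `q ≡ 3 mod 4`, the elements of
`2`-power order lie in the quadratic subextension generated by a square root of `-1`. -/
lemma exists_eq_add_mul_of_pow_two_pow {F K : Type*} [Field F] [Finite F] [Field K] [Algebra F K]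
    [Finite K] (hq : Nat.card F % 4 = 3) {m : ℕ} (hm : Odd m) (hK : finrank F K = 2 * m)
    {i x : K} (hi : i * i = -1) {s : ℕ} (hx : x ^ 2 ^ s = 1) :
    ∃ α β : F, x = algebraMap F K α + algebraMap F K β * i := by
  have := Fintype.ofFinite F
  have := Fintype.ofFinite K
  have h2 : algebraMap F K 2 ≠ 0 := by
    rw [ne_eq, map_eq_zero]; exact two_ne_zero_of_card hq
  rw [Nat.card_eq_fintype_card] at hq
  set q := Fintype.card F with hqdef
  have hi0 : i ≠ 0 := by rintro rfl; simp at hi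
  have hx0 : x ≠ 0 := by
    rintro rfl
    rw [zero_pow (by positivity)] at hx
    exact zero_ne_one hx
  have hxK : x ^ ((q ^ 2) ^ m - 1) = 1 := by
    have := FiniteField.pow_card_sub_one_eq_one x hx0
    rwa [Module.card_eq_pow_finrank (K := F) (V := K), hK, pow_mul] at this
  have hqodd : Odd q := Nat.odd_iff.2 (by omega)
  -- The index `(q^(2m) - 1) / (q² - 1)` is a sum of `m` odd terms, hence odd; so the order of `x`
  -- divides `q² - 1`.
  have hsum : Odd (∑ k ∈ Finset.range m, (q ^ 2) ^ k) := by
    rw [Finset.odd_sum_iff_odd_card_odd]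
    rw [Finset.filter_true_of_mem fun k _ => (hqodd.pow).pow, Finset.card_range]
    exact hm
  have hgeom : (q ^ 2 - 1) * (∑ k ∈ Finset.range m, (q ^ 2) ^ k) = (q ^ 2) ^ m - 1 := by
    have h1 : 1 ≤ q ^ 2 := Nat.one_le_pow _ _ hqodd.pos
    have := Nat.geomSum_eq (m := q ^ 2) (by nlinarith [show 3 ≤ q by omega]) m
    rw [this]
    exact Nat.mul_div_cancel' (by simpa using Nat.sub_dvd_pow_sub_pow (q ^ 2) 1 m)
  have hord : orderOf x ∣ q ^ 2 - 1 := by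
    have h1 : orderOf x ∣ 2 ^ s := orderOf_dvd_of_pow_eq_one hx
    have h2 : orderOf x ∣ (q ^ 2 - 1) * (∑ k ∈ Finset.range m, (q ^ 2) ^ k) := by
      rw [hgeom]; exact orderOf_dvd_of_pow_eq_one hxK
    exact (Nat.Coprime.coprime_dvd_left h1
      (Nat.Coprime.pow_left _ (Nat.coprime_two_left.2 hsum))).dvd_of_dvd_mul_right h2
  have hxq : (x ^ q) ^ q = x := by
    rw [← pow_mul, ← sq]
    have h1 : 1 ≤ q ^ 2 := Nat.one_le_pow _ _ hqodd.pos
    obtain ⟨n, hn⟩ : ∃ n, q ^ 2 = n + 1 := ⟨q ^ 2 - 1, by omega⟩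
    rw [hn, pow_succ, orderOf_dvd_iff_pow_eq_one.1 (by rwa [hn, Nat.add_sub_cancel] at hord),
      one_mul]
  have hiq : i ^ q = -i := by
    obtain ⟨u, hu⟩ : ∃ u, q = 4 * u + 3 := ⟨q / 4, by omega⟩
    have h4 : i ^ 4 = 1 := by rw [show i ^ 4 = (i * i) * (i * i) by ring, hi]; ring
    rw [hu, pow_add, pow_mul, h4, one_pow, one_mul, show i ^ 3 = (i * i) * i by ring, hi]
    ring
  let φ := FiniteField.frobeniusAlgHom F K
  have hφ : ∀ y, φ y = y ^ q := fun y => rfl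
  -- Since `x^(q²) = x` and `i^q = -i`, both `x + x^q` and `(x - x^q) / i` are fixed by Frobenius;
  -- their halves are the two coordinates.
  obtain ⟨t, ht⟩ : ∃ t : F, algebraMap F K t = x + x ^ q := by
    apply mem_range_algebraMap_of_pow_card
    change φ _ = _
    rw [map_add, hφ, hφ, hxq, add_comm]
  obtain ⟨u, hu⟩ : ∃ u : F, algebraMap F K u = (x - x ^ q) * i⁻¹ := by
    apply mem_range_algebraMap_of_pow_card
    change φ _ = _
    rw [map_mul, map_sub, map_inv₀, hφ, hφ, hφ, hxq, hiq, inv_neg]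
    ring
  refine ⟨t / 2, u / 2, ?_⟩
  rw [map_div₀, map_div₀, ht, hu]
  field_simp
  rw [map_ofNat]
  ring

end FiniteFields

end LinGroup

namespace LinGroup

open Module

/-! ### The field centralising `a` and `c`, and its square root of `-1`. -/

/-- Endomorphisms `c`, `a`, `g` of a space of dimension `2m`, `m` odd, over a field of order
`q ≡ 3 mod 4`: `c` is of odd order and central, `a` of `2`-power order at least `4`, `g` normalises
`⟨a⟩` without centralising it, `g ^ 2 ∈ ⟨a⟩`, and `⟨c, a⟩` is irreducible. -/
structure QuatConfig {F V : Type*} [Field F] [AddCommGroup V] [Module F V] (m : ℕ)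
    (c a g : End F V) : Prop where
  card_mod : Nat.card F % 4 = 3
  odd_m : Odd m
  finrank_eq : finrank F V = 2 * m
  comm_ac : Commute a c
  comm_gc : Commute g c
  c_pow : ∃ N, Odd N ∧ c ^ N = 1
  a_pow : ∃ s, a ^ 2 ^ (s + 2) = 1 ∧ a ^ 2 ^ (s + 1) ≠ 1
  g_a : ∃ e : ℕ, g * a = a ^ e * g
  g_sq : ∃ f : ℕ, g * g = a ^ f
  not_comm : ¬ Commute g a
  irred : ∀ W : Submodule F V, W.map c ≤ W → W.map a ≤ W → W = ⊥ ∨ W = ⊤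

namespace QuatConfig

variable {F V : Type*} [Field F] [AddCommGroup V] [Module F V] {m : ℕ} {c a g : End F V}

lemma finiteDimensional (h : QuatConfig m c a g) : FiniteDimensional F V :=
  FiniteDimensional.of_finrank_pos (by rw [h.finrank_eq]; have := h.odd_m.pos; omega)

lemma nontrivial (h : QuatConfig m c a g) : Nontrivial V :=
  Module.nontrivial_of_finrank_pos (R := F) (by rw [h.finrank_eq]; have := h.odd_m.pos; omega)

lemma two_ne_zero [Finite F] (h : QuatConfig m c a g) : (2 : F) ≠ 0 := two_ne_zero_of_card h.card_mod

lemma c_injective (h : QuatConfig m c a g) : Function.Injective c := by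
  obtain ⟨N, hN, hc⟩ := h.c_pow
  exact injective_of_pow_eq_one hN.pos hc

lemma a_injective (h : QuatConfig m c a g) : Function.Injective a := by
  obtain ⟨s, hs, -⟩ := h.a_pow
  exact injective_of_pow_eq_one (by positivity) hs

lemma g_injective (h : QuatConfig m c a g) : Function.Injective g := by
  obtain ⟨f, hf⟩ := h.g_sq
  have : Function.Injective (g * g : End F V) := by
    rw [hf, Module.End.coe_pow]; exact h.a_injective.iterate f
  exact Function.Injective.of_comp (f := g) this

/-- Schur's lemma. -/
lemma injective_of_commute (h : QuatConfig m c a g) {T : End F V} (hTa : Commute T a)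
    (hTc : Commute T c) (hT : T ≠ 0) : Function.Injective T := by
  have key : ∀ {b : End F V}, Commute T b → (LinearMap.ker T).map b ≤ LinearMap.ker T := by
    rintro b hb _ ⟨w, hw, rfl⟩
    have hw' : T w = 0 := hw
    rw [LinearMap.mem_ker, ← Module.End.mul_apply, hb.eq, Module.End.mul_apply, hw', map_zero]
  rcases h.irred _ (key hTc) (key hTa) with h0 | h0
  · exact LinearMap.ker_eq_bot.1 h0
  · exact absurd (LinearMap.ker_eq_top.1 h0) hT

/-- The endomorphisms commuting with `a` and `c`. -/
abbrev centr (F : Type*) {V : Type*} [Field F] [AddCommGroup V] [Module F V] (c a : End F V) :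
    Subalgebra F (End F V) :=
  Subalgebra.centralizer F {a, c}

lemma mem_centr {T : End F V} : T ∈ centr F c a ↔ Commute T a ∧ Commute T c := by
  rw [Subalgebra.mem_centralizer_iff]
  exact ⟨fun h => ⟨(h a (by simp)).symm, (h c (by simp)).symm⟩, by
    rintro ⟨h1, h2⟩ _ (rfl | rfl)
    exacts [h1.symm, h2.symm]⟩

/-- Schur's lemma excludes zero divisors, and a finite domain is a field. -/
lemma isField_of_le_centr [Finite F] (h : QuatConfig m c a g) {S : Subalgebra F (End F V)}
    (hS : S ≤ centr F c a) : IsField S := by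
  have := h.finiteDimensional
  have := h.nontrivial
  have : Finite (End F V) := Module.finite_of_finite F
  have : Finite S := Subtype.finite
  have hnz : NoZeroDivisors S := by
    refine ⟨fun {x y} hxy => ?_⟩
    by_contra! hne
    obtain ⟨hxa, hxc⟩ := mem_centr.1 (hS x.2)
    have hx := h.injective_of_commute hxa hxc (fun h0 => hne.1 (Subtype.ext h0))
    apply hne.2
    apply Subtype.ext
    ext w
    apply hx
    have := LinearMap.congr_fun (congrArg Subtype.val hxy) w
    simpa using this
  have : IsDomain S := NoZeroDivisors.to_isDomain S
  exact Finite.isDomain_to_isField S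

/-- Evaluation of endomorphisms in an algebra at a vector. -/
def evalAt (S : Subalgebra F (End F V)) (v : V) : S →ₗ[F] V :=
  (LinearMap.applyₗ v : End F V →ₗ[F] V) ∘ₗ S.val.toLinearMap

@[simp] lemma evalAt_apply (S : Subalgebra F (End F V)) (v : V) (T : S) :
    evalAt S v T = (T : End F V) v := rfl

lemma range_evalAt_map_le (S : Subalgebra F (End F V)) (v : V) {b : End F V} (hb : b ∈ S) :
    (LinearMap.range (evalAt S v)).map b ≤ LinearMap.range (evalAt S v) := by
  rintro _ ⟨_, ⟨T, rfl⟩, rfl⟩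
  exact ⟨⟨b, hb⟩ * T, rfl⟩

lemma mem_range_evalAt (S : Subalgebra F (End F V)) (v : V) : v ∈ LinearMap.range (evalAt S v) :=
  ⟨1, rfl⟩

lemma evalAt_injective (h : QuatConfig m c a g) {S : Subalgebra F (End F V)}
    (hS : S ≤ centr F c a) {v : V} (hv : v ≠ 0) : Function.Injective (evalAt S v) := by
  rw [injective_iff_map_eq_zero]
  intro T hT
  by_contra hne
  obtain ⟨hTa, hTc⟩ := mem_centr.1 (hS T.2)
  have := h.injective_of_commute hTa hTc (fun h0 => hne (Subtype.ext h0))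
  exact hv (this (by rw [map_zero]; exact hT))

/-- Evaluation at a nonzero vector is injective by Schur's lemma. Its image is invariant under `a`
and `c`, which themselves lie in the centraliser, so by irreducibility it is all of `V`. -/
lemma finrank_centr (h : QuatConfig m c a g) : finrank F (centr F c a) = 2 * m := by
  have := h.nontrivial
  obtain ⟨v, hv⟩ := exists_ne (0 : V)
  rw [← h.finrank_eq]
  refine LinearEquiv.finrank_eq (LinearEquiv.ofBijective (evalAt (centr F c a) v)
    ⟨h.evalAt_injective le_rfl hv, ?_⟩)
  rw [← LinearMap.range_eq_top]
  have hmem := mem_range_evalAt (centr F c a) v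
  refine (h.irred _ (range_evalAt_map_le _ v ?_) (range_evalAt_map_le _ v ?_)).resolve_left ?_
  · exact mem_centr.2 ⟨h.comm_ac.symm, Commute.refl c⟩
  · exact mem_centr.2 ⟨Commute.refl a, h.comm_ac⟩
  · intro h0; rw [h0] at hmem; exact hv hmem

/-- `a` lies in the quadratic extension generated by a square root `i` of `-1`, and `g` induces
the nontrivial automorphism of that extension. -/
lemma exists_sqrt_neg_one [Finite F] (h : QuatConfig m c a g) :
    ∃ (i : End F V) (α β : F), i * i = -1 ∧ Commute i c ∧ a = α • 1 + β • i ∧ β ≠ 0 ∧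
      g * i = -(i * g) := by
  have hfd := h.finiteDimensional
  have hnt := h.nontrivial
  obtain ⟨s, hs, hs1⟩ := h.a_pow
  let K := centr F c a
  have haK : a ∈ K := mem_centr.2 ⟨Commute.refl a, h.comm_ac⟩
  have hField : IsField K := h.isField_of_le_centr le_rfl
  let : Field K := hField.toField
  have : Finite (End F V) := Module.finite_of_finite F
  have : Finite K := Subtype.finite
  let x : K := ⟨a, haK⟩
  let i : K := x ^ 2 ^ s
  have hi2 : i ^ 2 = x ^ 2 ^ (s + 1) := by rw [← pow_mul, ← pow_succ]
  have hi4 : (i ^ 2) * (i ^ 2) = 1 := by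
    rw [hi2, ← pow_two, ← pow_mul, ← pow_succ]; exact Subtype.ext hs
  have hi : i * i = -1 := by
    rw [← pow_two]
    refine (mul_self_eq_one_iff.1 hi4).resolve_left fun h1 => hs1 ?_
    rw [hi2] at h1
    exact congrArg Subtype.val h1
  obtain ⟨α, β, hab⟩ := exists_eq_add_mul_of_pow_two_pow h.card_mod h.odd_m h.finrank_centr hi
    (x := x) (s := s + 2) (Subtype.ext hs)
  have hiV : (i : End F V) * i = -1 := congrArg Subtype.val hi
  have hia : (i : End F V) = a ^ 2 ^ s := rfl
  have haV : a = α • 1 + β • (i : End F V) := by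
    have := congrArg Subtype.val hab
    rw [Algebra.algebraMap_eq_smul_one, Algebra.algebraMap_eq_smul_one, smul_mul_assoc,
      one_mul] at this
    exact this
  have hncomm : ¬ Commute g (i : End F V) := by
    intro hc
    apply h.not_comm
    rw [haV]
    exact ((Commute.one_right g).smul_right α).add_right (hc.smul_right β)
  have hβ : β ≠ 0 := by
    rintro rfl
    apply h.not_comm
    rw [haV, zero_smul, add_zero]
    exact (Commute.one_right g).smul_right α
  refine ⟨i, α, β, hiV, (mem_centr.1 i.2).2, haV, hβ, ?_⟩
  obtain ⟨e, he⟩ := h.g_a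
  have hgi : g * i = (i : End F V) ^ e * g := by
    have : SemiconjBy g a (a ^ e) := he
    have := this.pow_right (2 ^ s)
    rw [← pow_mul, mul_comm e, pow_mul, ← hia] at this
    exact this
  -- For even `e`, `i^e = ±1`, and using `g i = ±g` twice gives `-g = g`. For odd `e`, `i^e = ±i`,
  -- and the plus sign would make `g` commute with `i`, hence with `a`.
  rcases Nat.even_or_odd e with ⟨k, hk⟩ | ⟨k, hk⟩
  · exfalso
    have hpow : (i : End F V) ^ e = (-1) ^ k := by rw [hk, ← two_mul, pow_mul, sq, hiV]
    rw [hpow] at hgi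
    have hs : SemiconjBy g (i : End F V) ((-1) ^ k) := hgi
    have h2 := hs.mul_right hs
    rw [hiV, ← pow_add, ← two_mul, pow_mul, neg_one_sq, one_pow] at h2
    have h3 : g * (-1) = 1 * g := h2
    rw [mul_neg, mul_one, one_mul] at h3
    obtain ⟨v, hv⟩ := exists_ne (0 : V)
    have h4 : (2 : F) • g v = 0 := by
      rw [two_smul]
      nth_rewrite 1 [← h3]
      simp
    have h5 := (smul_eq_zero.1 h4).resolve_left h.two_ne_zero
    exact hv (h.g_injective (h5.trans (map_zero g).symm))
  · have hpow : (i : End F V) ^ e = (-1) ^ k * i := by rw [hk, pow_succ, pow_mul, sq, hiV]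
    rw [hpow] at hgi
    rcases neg_one_pow_eq_or (End F V) k with h1 | h1
    · rw [h1, one_mul] at hgi
      exact absurd hgi hncomm
    · rw [h1] at hgi
      rw [hgi]; simp

end QuatConfig

end LinGroup

namespace LinGroup

open Module

namespace QuatConfig

variable {F V : Type*} [Field F] [AddCommGroup V] [Module F V] {m : ℕ} {c a g : End F V}

/-! ### The algebras `F[c^j]` and systems built from powers of `c`. -/

/-- The dimension of the algebra generated by `c ^ j`. -/
noncomputable def powDim (F : Type*) {V : Type*} [Field F] [AddCommGroup V] [Module F V]
    (c : End F V) (j : ℕ) : ℕ :=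
  finrank F (Algebra.adjoin F {c ^ j})

lemma adjoin_le_centr (h : QuatConfig m c a g) (j : ℕ) :
    Algebra.adjoin F {c ^ j} ≤ centr F c a := by
  rw [Algebra.adjoin_le_iff, Set.singleton_subset_iff]
  exact mem_centr.2 ⟨(h.comm_ac.pow_right j).symm, (Commute.refl c).pow_left j⟩

lemma powDim_dvd [Finite F] (h : QuatConfig m c a g) {j : ℕ} {W : Submodule F V}
    (hW : W.map (c ^ j) ≤ W) : powDim F c j ∣ finrank F W :=
  finrank_dvd_of_isField _ (h.isField_of_le_centr (h.adjoin_le_centr j)) W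
    fun _ hT => map_le_of_mem_adjoin hW hT

lemma commute_of_mem_adjoin {b : End F V} (hb : Commute b c) {j : ℕ} {T : End F V}
    (hT : T ∈ Algebra.adjoin F {c ^ j}) : Commute b T := by
  have : Algebra.adjoin F {c ^ j} ≤ Subalgebra.centralizer F {b} := by
    rw [Algebra.adjoin_le_iff, Set.singleton_subset_iff]
    rintro _ rfl
    exact hb.pow_right j
  exact this hT b rfl

lemma finrank_range_evalAt (h : QuatConfig m c a g) {v : V} (hv : v ≠ 0) (j : ℕ) :
    finrank F (LinearMap.range (evalAt (Algebra.adjoin F {c ^ j}) v)) = powDim F c j :=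
  LinearMap.finrank_range_of_inj (h.evalAt_injective (h.adjoin_le_centr j) hv)

lemma finrank_range_evalAt_le (h : QuatConfig m c a g) (v : V) (j : ℕ) :
    finrank F (LinearMap.range (evalAt (Algebra.adjoin F {c ^ j}) v)) ≤ powDim F c j := by
  have := h.finiteDimensional
  exact LinearMap.finrank_range_le _

/-- The sum of the cyclic `c ^ j`-submodules generated by `v` and `i v`. -/
def cyclicPair (c i : End F V) (j : ℕ) (v : V) : Submodule F V :=
  LinearMap.range (evalAt (Algebra.adjoin F {c ^ j}) v) ⊔
    LinearMap.range (evalAt (Algebra.adjoin F {c ^ j}) (i v))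

/-- The two summands may overlap; the upper bound suffices, since spanning then forces directness.
-/
lemma finrank_cyclicPair_le (h : QuatConfig m c a g) (i : End F V) (j : ℕ) (v : V) :
    finrank F (cyclicPair c i j v) ≤ 2 * powDim F c j := by
  have := h.finiteDimensional
  have h1 := h.finrank_range_evalAt_le v j
  have h2 := h.finrank_range_evalAt_le (i v) j
  have h3 := Submodule.finrank_add_le_finrank_add_finrank
    (LinearMap.range (evalAt (Algebra.adjoin F {c ^ j}) v))
    (LinearMap.range (evalAt (Algebra.adjoin F {c ^ j}) (i v)))
  unfold cyclicPair
  omega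

lemma mem_cyclicPair (c i : End F V) (j : ℕ) (v : V) : v ∈ cyclicPair c i j v :=
  Submodule.mem_sup_left (mem_range_evalAt _ v)

lemma cyclicPair_map_pow_le (c i : End F V) (j : ℕ) (v : V) :
    (cyclicPair c i j v).map (c ^ j) ≤ cyclicPair c i j v := by
  unfold cyclicPair
  rw [Submodule.map_sup]
  have hc : c ^ j ∈ Algebra.adjoin F {c ^ j} := Algebra.subset_adjoin rfl
  exact sup_le_sup (range_evalAt_map_le _ _ hc) (range_evalAt_map_le _ _ hc)

/-- An endomorphism commuting with `c` preserves the submodule generated by `v` and `i v` as soon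
as it preserves their linear span. -/
lemma cyclicPair_map_le {b i : End F V} (hb : Commute b c) {v : V} {x y z w : F}
    (h1 : b v = x • v + y • i v) (h2 : b (i v) = z • v + w • i v) (j : ℕ) :
    (cyclicPair c i j v).map b ≤ cyclicPair c i j v := by
  have key : ∀ (u : V) (r s : F), b u = r • v + s • i v →
      (LinearMap.range (evalAt (Algebra.adjoin F {c ^ j}) u)).map b ≤ cyclicPair c i j v := by
    rintro u r s hu _ ⟨_, ⟨T, rfl⟩, rfl⟩
    have : b (evalAt _ u T) = evalAt _ v (r • T) + evalAt _ (i v) (s • T) := by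
      rw [evalAt_apply, ← Module.End.mul_apply, (commute_of_mem_adjoin hb T.2).eq,
        Module.End.mul_apply, hu]
      simp
    rw [this]
    exact add_mem (Submodule.mem_sup_left ⟨_, rfl⟩) (Submodule.mem_sup_right ⟨_, rfl⟩)
  conv_lhs => unfold cyclicPair
  rw [Submodule.map_sup]
  exact sup_le (key v x y h1) (key (i v) z w h2)

lemma cyclicPair_map_a_le {i : End F V} {α β : F} (h : QuatConfig m c a g) (hi : i * i = -1)
    (hab : a = α • 1 + β • i) (j : ℕ) (v : V) :
    (cyclicPair c i j v).map a ≤ cyclicPair c i j v := by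
  have hii : i (i v) = - v := by
    have := LinearMap.congr_fun hi v
    simpa using this
  refine cyclicPair_map_le h.comm_ac (x := α) (y := β) (z := -β) (w := α) ?_ ?_ j
  · rw [hab]; simp
  · rw [hab]; simp [hii]; abel

/-- The algebra generated by `c` has dimension `m`. -/
lemma powDim_one [Finite F] (h : QuatConfig m c a g) : powDim F c 1 = m := by
  have hfd := h.finiteDimensional
  have hnt := h.nontrivial
  obtain ⟨v, hv⟩ := exists_ne (0 : V)
  obtain ⟨i, α, β, hi, hic, hab, hβ, hgi⟩ := h.exists_sqrt_neg_one
  have hdvd : powDim F c 1 ∣ 2 * m := by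
    have := h.powDim_dvd (j := 1) (W := ⊤) le_top
    rwa [finrank_top, h.finrank_eq] at this
  have hge : m ≤ powDim F c 1 := by
    have h1 := h.finrank_cyclicPair_le i 1 v
    have h2 : cyclicPair c i 1 v = ⊤ := by
      refine (h.irred _ ?_ (h.cyclicPair_map_a_le hi hab 1 v)).resolve_left ?_
      · simpa using cyclicPair_map_pow_le c i 1 v
      · intro h0
        have := mem_cyclicPair c i 1 v
        rw [h0] at this
        exact hv this
    rw [h2, finrank_top, h.finrank_eq] at h1
    omega
  have hne : powDim F c 1 ≠ 2 * m := by
    intro h0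
    have htop : LinearMap.range (evalAt (Algebra.adjoin F {c ^ 1}) v) = ⊤ := by
      apply Submodule.eq_top_of_finrank_eq
      rw [h.finrank_range_evalAt hv, h0, h.finrank_eq]
    -- If `V = F[c]v`, an operator commuting with `c` is determined by its value at `v`, so it acts
    -- as an element of `F[c]`. This contradicts `g i = -(i g)`.
    have hcomm : ∀ b₁ b₂ : End F V, Commute b₁ c → Commute b₂ c → b₁ * b₂ = b₂ * b₁ := by
      intro b₁ b₂ hb₁ hb₂
      have hex : ∀ u : V, ∃ T ∈ Algebra.adjoin F {c ^ 1}, T v = u := by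
        intro u
        have : u ∈ LinearMap.range (evalAt (Algebra.adjoin F {c ^ 1}) v) := htop ▸ trivial
        obtain ⟨T, hT⟩ := this
        exact ⟨T, T.2, hT⟩
      obtain ⟨T₁, hT₁, h1⟩ := hex (b₁ v)
      obtain ⟨T₂, hT₂, h2⟩ := hex (b₂ v)
      have hsw : ∀ {b T : End F V}, Commute b c → T ∈ Algebra.adjoin F {c ^ 1} → ∀ u,
          b (T u) = T (b u) := fun hb hT u =>
        LinearMap.congr_fun (commute_of_mem_adjoin hb hT).eq u
      have hT₁c : Commute T₁ c := (mem_centr.1 (h.adjoin_le_centr 1 hT₁)).2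
      ext u
      obtain ⟨T, hT, rfl⟩ := hex u
      rw [Module.End.mul_apply, Module.End.mul_apply, hsw hb₂ hT, hsw hb₁ hT, hsw hb₁ hT,
        hsw hb₂ hT, ← h1, ← h2, hsw hb₁ hT₂, hsw hb₂ hT₁, ← h1, ← h2, hsw hT₁c hT₂]
    have h1 := hcomm g i h.comm_gc hic
    rw [hgi] at h1
    have h2 : (2 : F) • i (g v) = 0 := by
      have := LinearMap.congr_fun h1 v
      simp only [LinearMap.neg_apply, Module.End.mul_apply] at this
      rw [two_smul]
      nth_rewrite 1 [← this]
      simp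
    have h3 := (smul_eq_zero.1 h2).resolve_left h.two_ne_zero
    have h4 : g v = 0 := by
      have := LinearMap.congr_fun hi (g v)
      simpa [h3] using this.symm
    exact hv (h.g_injective (h4.trans (map_zero g).symm))
  obtain ⟨t, ht⟩ := hdvd
  have hm := h.odd_m.pos
  have ht1 : t ≠ 0 := by rintro rfl; omega
  have ht2 : t ≠ 1 := by rintro rfl; omega
  have ht3 : 2 ≤ t := by omega
  nlinarith

/-- The subspace `F[c]v` has dimension `m` and is invariant under `c^j`, so `powDim F c j` divides
the odd number `m`. -/
lemma odd_powDim [Finite F] (h : QuatConfig m c a g) (j : ℕ) : Odd (powDim F c j) := by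
  have hnt := h.nontrivial
  obtain ⟨v, hv⟩ := exists_ne (0 : V)
  have h1 := h.finrank_range_evalAt hv 1
  rw [h.powDim_one] at h1
  refine h.odd_m.of_dvd_nat ?_
  rw [← h1]
  refine h.powDim_dvd (map_pow_le ?_ j)
  refine range_evalAt_map_le _ v ?_
  have : c ^ 1 ∈ Algebra.adjoin F {c ^ 1} := Algebra.subset_adjoin rfl
  rwa [pow_one] at this ⊢

/-- `g ^ 2 = ±1`. -/
lemma g_sq_eq [Finite F] (h : QuatConfig m c a g) : g * g = 1 ∨ g * g = -1 := by
  have hfd := h.finiteDimensional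
  have hnt := h.nontrivial
  obtain ⟨v, hv⟩ := exists_ne (0 : V)
  obtain ⟨i, α, β, hi, hic, hab, hβ, hgi⟩ := h.exists_sqrt_neg_one
  obtain ⟨f, hf⟩ := h.g_sq
  obtain ⟨s, hs, -⟩ := h.a_pow
  have hpow : ∀ n : ℕ, ∃ γ δ : F, a ^ n = γ • 1 + δ • i := by
    intro n
    induction n with
    | zero => exact ⟨1, 0, by simp⟩
    | succ n ih =>
      obtain ⟨γ, δ, hn⟩ := ih
      refine ⟨γ * α - δ * β, γ * β + δ * α, ?_⟩
      rw [pow_succ, hn, hab]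
      simp only [add_mul, mul_add, smul_mul_smul_comm, mul_one, one_mul, hi]
      module
  obtain ⟨γ, δ, hγ⟩ := hpow f
  -- `g` commutes with `g² = γ + δi` but anticommutes with `i`.
  have hδ : δ = 0 := by
    have h1 : g * (g * g) = (g * g) * g := (mul_assoc _ _ _).symm
    rw [hf, hγ, mul_add, add_mul, mul_smul_comm, mul_smul_comm, hgi, smul_mul_assoc,
      smul_mul_assoc, mul_one, one_mul, add_right_inj] at h1
    by_contra hδ
    have h2 := LinearMap.congr_fun h1 v
    simp only [LinearMap.smul_apply, LinearMap.neg_apply, Module.End.mul_apply] at h2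
    have h3 : (2 * δ) • i (g v) = 0 := by
      rw [two_mul, add_smul]
      nth_rewrite 1 [← h2]
      simp
    have h4 := (smul_eq_zero.1 h3).resolve_left (mul_ne_zero h.two_ne_zero hδ)
    have h5 : g v = 0 := by
      have := LinearMap.congr_fun hi (g v)
      simpa [h4] using this.symm
    exact hv (h.g_injective (h5.trans (map_zero g).symm))
  rw [hδ, zero_smul, add_zero] at hγ
  have hγ1 : γ ^ 2 ^ (s + 2) = 1 := by
    have : (a ^ f) ^ 2 ^ (s + 2) = 1 := by rw [← pow_mul, mul_comm, pow_mul, hs, one_pow]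
    rw [hγ, smul_pow, one_pow] at this
    have h2 := LinearMap.congr_fun this v
    simp only [LinearMap.smul_apply, Module.End.one_apply] at h2
    exact smul_left_injective F hv (by simpa using h2)
  rw [hf, hγ]
  rcases eq_one_or_neg_one_of_pow h.card_mod hγ1 with rfl | rfl
  · left; simp
  · right; simp

/-- There is a plane invariant under `a` and `g`. -/
lemma exists_invariant_plane [Finite F] (h : QuatConfig m c a g) {i : End F V} (hi : i * i = -1)
    (hgi : g * i = -(i * g)) : ∃ (v : V) (x y : F), v ≠ 0 ∧ g v = x • v + y • i v := by
  have hnt := h.nontrivial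
  obtain ⟨w, hw⟩ := exists_ne (0 : V)
  -- The coefficients make `k = (x + yi)g` an involution, as `k² = (x² + y²)g²`. For `g² = -1` this
  -- needs `-1` as a sum of two squares, available in any finite field.
  obtain ⟨x, y, ε, hε, hxy⟩ : ∃ x y ε : F, g * g = ε • 1 ∧ (x * x + y * y) * ε = 1 := by
    rcases h.g_sq_eq with h1 | h1
    · exact ⟨1, 0, 1, by simp [h1], by simp⟩
    · have := Fintype.ofFinite F
      obtain ⟨x, y, hxy⟩ := FiniteField.exists_root_sum_quadratic
        (R := F) (f := Polynomial.X ^ 2) (g := Polynomial.X ^ 2 - Polynomial.C (-1))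
        (by simp) (Polynomial.degree_X_pow_sub_C (by norm_num) _) (by
          have := h.card_mod
          rw [Nat.card_eq_fintype_card] at this
          omega)
      refine ⟨x, y, -1, by simp [h1], ?_⟩
      simp at hxy
      linear_combination -hxy
  have hii : ∀ u, i (i u) = -u := fun u => by
    have := LinearMap.congr_fun hi u
    simpa using this
  have hg : ∀ u, g (i u) = -i (g u) := fun u => LinearMap.congr_fun hgi u
  have hgg : ∀ u, g (g u) = ε • u := fun u => LinearMap.congr_fun hε u
  let k : V → V := fun u => x • g u + y • i (g u)
  have hkk : ∀ u, k (k u) = u := by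
    intro u
    simp only [k, map_add, map_smul, hg, hgg, map_neg, hii]
    calc _ = ((x * x + y * y) * ε) • u := by module
      _ = u := by rw [hxy, one_smul]
  obtain ⟨v, ρ, hv, hkv⟩ : ∃ (v : V) (ρ : F), v ≠ 0 ∧ k v = ρ • v := by
    by_cases h0 : k w = - w
    · exact ⟨w, -1, hw, by rw [h0]; simp⟩
    · refine ⟨k w + w, 1, fun h1 => h0 (eq_neg_of_add_eq_zero_left h1), ?_⟩
      have hadd : k (k w + w) = k (k w) + k w := by
        simp only [k, map_add]; module
      rw [hadd, hkk, one_smul, add_comm]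
  -- Multiplying `(x + yi) g v = ρ v` by `ε(x - yi)` solves for `g v`.
  refine ⟨v, ε * x * ρ, -(ε * y * ρ), hv, ?_⟩
  have hkv' : x • g v + y • i (g v) = ρ • v := hkv
  have h1 : ((x * x + y * y) * ε) • g v = (ε * x * ρ) • v + (-(ε * y * ρ)) • i v := by
    calc ((x * x + y * y) * ε) • g v
        = (ε * x) • (x • g v + y • i (g v)) - (ε * y) • i (x • g v + y • i (g v)) := by
          simp only [map_add, map_smul, hii]; module
      _ = _ := by rw [hkv']; simp only [map_smul]; module
  rwa [hxy, one_smul] at h1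

/-- If `j * powDim F c j ∣ m` then `⟨c, a, g⟩` has a system of imprimitivity of size `j`. -/
lemma exists_system [Finite F] (h : QuatConfig m c a g) {j : ℕ} (hj : j * powDim F c j ∣ m) :
    ∃ W : Fin j → Submodule F V, (∀ i, W i ≠ ⊥) ∧ DirectSum.IsInternal W ∧
      Permutes W c ∧ Permutes W a ∧ Permutes W g := by
  have hfd := h.finiteDimensional
  obtain ⟨i, α, β, hi, hic, hab, hβ, hgi⟩ := h.exists_sqrt_neg_one
  obtain ⟨v, x, y, hv, hgv⟩ := h.exists_invariant_plane hi hgi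
  have hii : i (i v) = - v := by
    have := LinearMap.congr_fun hi v
    simpa using this
  have hgiv : g (i v) = y • v + (-x) • i v := by
    have : g (i v) = -i (g v) := LinearMap.congr_fun hgi v
    rw [this, hgv]
    simp only [map_add, map_smul, hii]; module
  let W := cyclicPair c i j v
  have hWc : W.map (c ^ j) ≤ W := cyclicPair_map_pow_le c i j v
  have hWa : W.map a ≤ W := h.cyclicPair_map_a_le hi hab j v
  have hWg : W.map g ≤ W := cyclicPair_map_le h.comm_gc hgv hgiv j
  have hvW : v ∈ W := mem_cyclicPair c i j v
  have hm := h.odd_m.pos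
  have hjpos : 0 < j := Nat.pos_of_dvd_of_pos (dvd_of_mul_right_dvd hj) hm
  have hpc := permutes_translates h.c_injective hWc
  have hpa := permutes_translates_of_commute (j := j) h.a_injective h.comm_ac.symm hWa
  have hpg := permutes_translates_of_commute (j := j) h.g_injective h.comm_gc.symm hWg
  have hle : j * finrank F W ≤ finrank F V := by
    have h1 : finrank F W ≤ 2 * powDim F c j := h.finrank_cyclicPair_le i j v
    have h2 := Nat.le_of_dvd hm hj
    rw [h.finrank_eq]
    nlinarith
  -- The span of the translates is invariant under both `c` and `a`, hence everything by
  -- irreducibility.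
  have htop : ⨆ i : Fin j, W.map (c ^ (i : ℕ)) = ⊤ := by
    refine (h.irred _ (iSup_translates_map_le h.c_injective hWc) ?_).resolve_left ?_
    · rw [Submodule.map_iSup, iSup_le_iff]
      intro k
      obtain ⟨l, hl⟩ := hpa k
      exact hl.trans_le (le_iSup (fun i : Fin j => W.map (c ^ (i : ℕ))) l)
    · intro h0
      have h1 : W.map (c ^ 0) ≤ ⊥ := h0 ▸ le_iSup (fun i : Fin j => W.map (c ^ (i : ℕ))) ⟨0, hjpos⟩
      rw [pow_zero, Module.End.one_eq_id, Submodule.map_id] at h1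
      exact hv (h1 hvW)
  refine ⟨fun k : Fin j => W.map (c ^ (k : ℕ)), fun k hk => ?_, isInternal_translates htop hle,
    hpc, hpa, hpg⟩
  have hinj : Function.Injective (c ^ (k : ℕ) : End F V) := by
    rw [Module.End.coe_pow]; exact h.c_injective.iterate _
  have h1 : (c ^ (k : ℕ)) v ∈ W.map (c ^ (k : ℕ)) := Submodule.mem_map_of_mem hvW
  have h2 : (c ^ (k : ℕ)) v = 0 := by
    have h3 : W.map (c ^ (k : ℕ)) = ⊥ := hk
    rwa [h3, Submodule.mem_bot] at h1
  exact hv (hinj (h2.trans (map_zero _).symm))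

end QuatConfig

end LinGroup

namespace LinGroup

open Module

/-! ### Two blocks of odd dimension, and the quaternion relations. -/

/-- A direct decomposition into two subspaces permuted by `f` is preserved by `f` or
swapped by `f`. -/
lemma Permutes.fixes_or_swaps {F X : Type*} [Field F] [AddCommGroup X] [Module F X]
    {U : Fin 2 → Submodule F X} (hU : DirectSum.IsInternal U) (hne : ∀ i, U i ≠ ⊥) {f : End F X}
    (hf : Function.Injective f) (hp : Permutes U f) :
    (U 0).map f = U 0 ∨ ((U 0).map f = U 1 ∧ (U 1).map f = U 0) := by
  obtain ⟨i, hi⟩ := hp 0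
  obtain ⟨j, hj⟩ := hp 1
  have hinj := hU.submodule_iSupIndep.injective hne
  fin_cases i
  · exact Or.inl hi
  · fin_cases j
    · exact Or.inr ⟨hi, hj⟩
    · have := hinj (Submodule.map_injective_of_injective hf (hi.trans hj.symm))
      exact absurd this (by decide)

lemma Permutes.map_mul_self_le {F X : Type*} [Field F] [AddCommGroup X] [Module F X]
    {U : Fin 2 → Submodule F X} (hU : DirectSum.IsInternal U) (hne : ∀ i, U i ≠ ⊥) {f : End F X}
    (hf : Function.Injective f) (hp : Permutes U f) : (U 0).map (f * f) ≤ U 0 := by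
  rw [Module.End.mul_eq_comp, Submodule.map_comp]
  rcases hp.fixes_or_swaps hU hne hf with h | ⟨h1, h2⟩
  · rw [h, h]
  · rw [h1, h2]

namespace QuatConfig

variable {F V : Type*} [Field F] [AddCommGroup V] [Module F V] {m : ℕ} {c a g : End F V}

/-- If `f` is an operator of odd order whose powers have the same invariant dimensions as those
of `c`, and there is no decomposition coming from a proper power of `c`, then `f` preserves each
member of any direct decomposition that it permutes. -/
lemma blocks_invariant [Finite F] (h : QuatConfig m c a g) {X : Type*} [AddCommGroup X] [Module F X]
    [FiniteDimensional F X] {ι : Type*} [Fintype ι] [DecidableEq ι] {U : ι → Submodule F X}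
    (hU : DirectSum.IsInternal U) (hne : ∀ i, U i ≠ ⊥) {f : End F X} {N : ℕ} (hN : Odd N)
    (hf : f ^ N = 1) (hp : Permutes U f) {r : ℕ} (hr : r = 1 ∨ r = 2) (hX : finrank F X = r * m)
    (hd : ∀ j (W : Submodule F X), W.map (f ^ j) ≤ W → powDim F c j ∣ finrank F W)
    (hprim : ∀ j, 1 < j → ¬ j * powDim F c j ∣ m) :
    (∀ i, (U i).map f ≤ U i) ∧ (∀ i, m ≤ finrank F (U i)) ∧ Fintype.card ι ≤ r := by
  have hm := h.odd_m.pos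
  have hinv : ∀ i, (U i).map f ≤ U i := by
    intro i
    obtain ⟨j, hj0, hj, hj1⟩ := exists_orbit_length hU hne hN hf hp hm hr hX h.odd_powDim hd
      h.powDim_one i
    refine hj1 ?_
    by_contra hne1
    exact hprim j (by omega) hj
  have hge : ∀ i, m ≤ finrank F (U i) := by
    intro i
    have h1 := hd 1 (U i) (by rw [pow_one]; exact hinv i)
    rw [h.powDim_one] at h1
    exact Nat.le_of_dvd (Nat.pos_of_ne_zero fun h0 => hne i (Submodule.finrank_eq_zero.1 h0)) h1
  refine ⟨hinv, hge, ?_⟩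
  have hsum := finrank_iSup_of_iSupIndep hU.submodule_iSupIndep
  rw [hU.submodule_iSup_eq_top, finrank_top, hX] at hsum
  have : Fintype.card ι * m ≤ r * m := by
    rw [hsum, ← smul_eq_mul, ← Finset.card_univ]
    exact Finset.card_nsmul_le_sum _ _ _ fun i _ => hge i
  exact Nat.le_of_mul_le_mul_right this hm

/-- Without decompositions coming from proper powers of `c`, every direct decomposition of `V`
permuted by `c` into more than one subspace consists of two `c`-invariant subspaces of
dimension `m`. -/
lemma two_blocks [Finite F] (h : QuatConfig m c a g) {k : ℕ} (hk : 1 < k)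
    {U : Fin k → Submodule F V} (hU : DirectSum.IsInternal U) (hne : ∀ i, U i ≠ ⊥)
    (hp : Permutes U c) (hprim : ∀ j, 1 < j → ¬ j * powDim F c j ∣ m) :
    k = 2 ∧ (∀ i, (U i).map c ≤ U i) ∧ ∀ i, finrank F (U i) = m := by
  have hfd := h.finiteDimensional
  obtain ⟨N, hN, hc⟩ := h.c_pow
  obtain ⟨h1, h2, h3⟩ := h.blocks_invariant hU hne hN hc hp (Or.inr rfl) h.finrank_eq
    (fun j W => h.powDim_dvd) hprim
  rw [Fintype.card_fin] at h3
  obtain rfl : k = 2 := by omega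
  have hsum := finrank_iSup_of_iSupIndep hU.submodule_iSupIndep
  rw [hU.submodule_iSup_eq_top, finrank_top, h.finrank_eq, Fin.sum_univ_two] at hsum
  have h20 := h2 0
  have h21 := h2 1
  refine ⟨rfl, h1, fun i => ?_⟩
  fin_cases i
  · change finrank F (U 0) = m; omega
  · change finrank F (U 1) = m; omega

/-- `a²` preserves the block `U 0`. If `α ≠ 0`, then `a² = (α² - β²) + 2αβi` shows that `i`
preserves it too, against the oddness of `m`. So `a = βi`, and `a² = -β²` is a scalar of 2-power
order, hence `±1`; the value `1` contradicts the order of `a`. -/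
lemma relations_of_two_blocks [Finite F] (h : QuatConfig m c a g) {U : Fin 2 → Submodule F V}
    (hU : DirectSum.IsInternal U) (hne : ∀ i, U i ≠ ⊥) (hp : Permutes U a)
    (hdim : finrank F (U 0) = m) : a * a = -1 ∧ g * a = -(a * g) := by
  have hfd := h.finiteDimensional
  have hnt := h.nontrivial
  obtain ⟨v, hv⟩ := exists_ne (0 : V)
  obtain ⟨i, α, β, hi, hic, hab, hβ, hgi⟩ := h.exists_sqrt_neg_one
  obtain ⟨s, hs, hs1⟩ := h.a_pow
  have haa : a * a = (α * α - β * β) • 1 + (2 * (α * β)) • i := by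
    rw [hab]
    simp only [add_mul, mul_add, smul_mul_smul_comm, mul_one, one_mul, hi]
    module
  have hα : α = 0 := by
    by_contra hα
    have hne0 : 2 * (α * β) ≠ 0 := mul_ne_zero h.two_ne_zero (mul_ne_zero hα hβ)
    have hinv : (U 0).map i ≤ U 0 := by
      rintro _ ⟨w, hw, rfl⟩
      have h1 : (a * a) w ∈ U 0 := hp.map_mul_self_le hU hne h.a_injective
        (Submodule.mem_map_of_mem hw)
      rw [haa] at h1
      simp only [LinearMap.add_apply, LinearMap.smul_apply, Module.End.one_apply] at h1
      rw [Submodule.add_mem_iff_right _ (Submodule.smul_mem _ _ hw)] at h1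
      exact (Submodule.smul_mem_iff _ hne0).1 h1
    have := even_finrank_of_sq_eq_neg_one (not_isSquare_neg_one h.card_mod) hi hinv
    rw [hdim] at this
    exact Nat.not_odd_iff_even.2 this h.odd_m
  subst hα
  rw [zero_smul, zero_add] at hab
  have haa' : a * a = (-(β * β)) • 1 := by rw [haa]; simp
  have hpow : (-(β * β)) ^ 2 ^ (s + 1) = 1 := by
    have h1 : (a * a) ^ 2 ^ (s + 1) = 1 := by rw [← sq, ← pow_mul, ← pow_succ', hs]
    rw [haa', smul_pow, one_pow] at h1
    have h2 := LinearMap.congr_fun h1 v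
    simp only [LinearMap.smul_apply, Module.End.one_apply] at h2
    exact smul_left_injective F hv (by simpa using h2)
  refine ⟨?_, ?_⟩
  · rcases eq_one_or_neg_one_of_pow h.card_mod hpow with h1 | h1
    · exfalso
      apply hs1
      rw [pow_succ', pow_mul, sq, haa', h1, one_smul, one_pow]
    · rw [haa', h1]; simp
  · rw [hab, mul_smul_comm, hgi, smul_mul_assoc, smul_neg]

/-- If `g` is an involution that anticommutes with `a`, its eigenspaces are permuted by
`c`, `a` and `g`. -/
lemma exists_system_of_involution [Finite F] (h : QuatConfig m c a g) (haa : a * a = -1)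
    (hga : g * a = -(a * g)) (hgg : g * g = 1) :
    ∃ W : Fin 2 → Submodule F V, (∀ i, W i ≠ ⊥) ∧ DirectSum.IsInternal W ∧
      Permutes W c ∧ Permutes W a ∧ Permutes W g := by
  have hfd := h.finiteDimensional
  have hnt := h.nontrivial
  have h2 := h.two_ne_zero
  have ha2 : ∀ u, a (a u) = -u := fun u => LinearMap.congr_fun haa u
  have hg2 : ∀ u, g (g u) = u := fun u => LinearMap.congr_fun hgg u
  have hg : ∀ u, g (a u) = -a (g u) := fun u => LinearMap.congr_fun hga u
  let E : F → Submodule F V := fun ε => LinearMap.ker (g - ε • 1)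
  have hE : ∀ ε u, u ∈ E ε ↔ g u = ε • u := fun ε u => by
    simp [E, sub_eq_zero]
  have hEinv : ∀ ε {b : End F V}, Function.Injective b → Commute g b → (E ε).map b = E ε := by
    intro ε b hb hgb
    apply map_eq_of_injective hb
    rintro _ ⟨u, hu, rfl⟩
    rw [hE, ← Module.End.mul_apply, hgb.eq, Module.End.mul_apply, (hE ε u).1 hu, map_smul]
  -- Anticommuting with `g`, `a` exchanges its two eigenspaces; in particular neither can vanish.
  have hEa : ∀ ε, (E ε).map a = E (-ε) := by
    have hle : ∀ ε, (E ε).map a ≤ E (-ε) := by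
      rintro ε _ ⟨u, hu, rfl⟩
      rw [hE, hg, (hE ε u).1 hu, map_smul, neg_smul]
    intro ε
    refine le_antisymm (hle ε) fun u hu => ?_
    have h1 := hle (-ε) (Submodule.mem_map_of_mem hu)
    rw [neg_neg] at h1
    exact ⟨-a u, (E ε).neg_mem h1, by rw [map_neg, ha2, neg_neg]⟩
  have hcompl : IsCompl (E 1) (E (-1)) := by
    constructor
    · rw [Submodule.disjoint_def]
      intro u hu hu'
      rw [hE] at hu hu'
      have h3 : (2 : F) • u = 0 := by
        have : (1 : F) • u = (-1 : F) • u := hu.symm.trans hu'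
        rw [two_smul]
        nth_rewrite 1 [← one_smul F u]
        rw [this]; simp
      exact (smul_eq_zero.1 h3).resolve_left h2
    · rw [codisjoint_iff, eq_top_iff]
      intro u _
      have hu : u = (2⁻¹ : F) • (u + g u) + (2⁻¹ : F) • (u - g u) := by
        rw [← smul_add, show u + g u + (u - g u) = (2 : F) • u by rw [two_smul]; abel, smul_smul,
          inv_mul_cancel₀ h2, one_smul]
      rw [hu]
      refine add_mem (Submodule.mem_sup_left (Submodule.smul_mem _ _ ?_))
        (Submodule.mem_sup_right (Submodule.smul_mem _ _ ?_))
      · rw [hE, map_add, hg2, one_smul, add_comm]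
      · rw [hE, map_sub, hg2, neg_smul, one_smul, neg_sub]
  have hne1 : E 1 ≠ ⊥ := by
    intro h0
    have h3 : E (-1) = ⊥ := by rw [← hEa, h0, Submodule.map_bot]
    have h4 := hcompl.sup_eq_top
    rw [h0, h3, sup_bot_eq] at h4
    exact bot_ne_top h4
  have hne2 : E (-1) ≠ ⊥ := by
    intro h0
    apply hne1
    rw [← neg_neg (1 : F), ← hEa, h0, Submodule.map_bot]
  refine ⟨![E 1, E (-1)], ?_, ?_, ?_, ?_, ?_⟩
  · intro i
    fin_cases i
    exacts [hne1, hne2]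
  · rw [DirectSum.isInternal_submodule_iff_isCompl _ (i := 0) (j := 1) (by decide)]
    · exact hcompl
    · ext i; fin_cases i <;> simp
  · intro i
    refine ⟨i, ?_⟩
    fin_cases i <;> exact hEinv _ h.c_injective h.comm_gc
  · intro i
    fin_cases i
    · exact ⟨1, hEa 1⟩
    · exact ⟨0, (hEa (-1)).trans (by rw [neg_neg]; rfl)⟩
  · intro i
    refine ⟨i, ?_⟩
    fin_cases i <;> exact hEinv _ h.g_injective (Commute.refl g)

/-- Under the quaternion relations, and without decompositions coming from proper powers of `c`,
no direct decomposition is permuted by `c`, `a` and `g`. -/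
lemma not_permutes [Finite F] (h : QuatConfig m c a g) (haa : a * a = -1) (hgg : g * g = -1)
    (hga : g * a = -(a * g)) (hprim : ∀ j, 1 < j → ¬ j * powDim F c j ∣ m) {k : ℕ} (hk : 1 < k)
    {U : Fin k → Submodule F V} (hU : DirectSum.IsInternal U) (hne : ∀ i, U i ≠ ⊥)
    (hpc : Permutes U c) (hpa : Permutes U a) (hpg : Permutes U g) : False := by
  have hfd := h.finiteDimensional
  obtain ⟨rfl, -, hdim⟩ := h.two_blocks hk hU hne hpc hprim
  have key : ∀ b : End F V, b * b = -1 → ¬ (U 0).map b ≤ U 0 := by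
    intro b hb hle
    have := even_finrank_of_sq_eq_neg_one (not_isSquare_neg_one h.card_mod) hb hle
    rw [hdim] at this
    exact Nat.not_odd_iff_even.2 this h.odd_m
  rcases hpa.fixes_or_swaps hU hne h.a_injective with h1 | ⟨-, h1⟩
  · exact key a haa h1.le
  rcases hpg.fixes_or_swaps hU hne h.g_injective with h2 | ⟨h2, -⟩
  · exact key g hgg h2.le
  -- Now both `a` and `g` swap the blocks, so their product preserves them, and it also has square
  -- `-1`.
  refine key (a * g) ?_ ?_
  · calc a * g * (a * g) = a * (g * a) * g := by simp only [mul_assoc]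
      _ = -(a * a * (g * g)) := by rw [hga]; simp only [mul_assoc, mul_neg, neg_mul]
      _ = -1 := by rw [haa, hgg]; simp
  · rw [Module.End.mul_eq_comp, Submodule.map_comp, h2, h1]

/-- If `j * powDim F c j ∣ m`, an irreducible operator of degree `m` which embeds into a power of
`c` permutes a direct decomposition of size `j`. -/
lemma exists_system_of_intertwining (h : QuatConfig m c a g) {X : Type*} [AddCommGroup X]
    [Module F X] [FiniteDimensional F X] (θ : X →ₗ[F] V) (hθ : Function.Injective θ) {f : End F X}
    (hf : Function.Injective f) {e : ℕ} (hfe : ∀ x, θ (f x) = (c ^ e) (θ x)) (hX : finrank F X = m)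
    (hirr : ∀ W : Submodule F X, W.map f ≤ W → W = ⊥ ∨ W = ⊤) {j : ℕ}
    (hj : j * powDim F c j ∣ m) :
    ∃ W : Fin j → Submodule F X, (∀ i, W i ≠ ⊥) ∧ DirectSum.IsInternal W ∧ Permutes W f := by
  have hm := h.odd_m.pos
  have hjpos : 0 < j := Nat.pos_of_dvd_of_pos (dvd_of_mul_right_dvd hj) hm
  have hnt : Nontrivial X := Module.nontrivial_of_finrank_pos (R := F) (by omega)
  have hfd := h.finiteDimensional
  obtain ⟨u, hu⟩ := exists_ne (0 : X)
  let S := Algebra.adjoin F {c ^ j}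
  -- The block is the preimage of a cyclic `F[c^j]`-module; it is `f^j`-invariant because `f`
  -- corresponds to `c^e`.
  let W := (LinearMap.range (evalAt S (θ u))).comap θ
  have huW : u ∈ W := mem_range_evalAt S (θ u)
  have hpow : ∀ n x, θ ((f ^ n) x) = ((c ^ e) ^ n) (θ x) := by
    intro n
    induction n with
    | zero => intro x; simp
    | succ n ih => intro x; rw [pow_succ, Module.End.mul_apply, ih, hfe, pow_succ (c ^ e)]; rfl
  have hWf : W.map (f ^ j) ≤ W := by
    rintro _ ⟨w, hw, rfl⟩
    change θ ((f ^ j) w) ∈ LinearMap.range (evalAt S (θ u))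
    rw [hpow, ← pow_mul, mul_comm, pow_mul]
    exact range_evalAt_map_le S (θ u) (S.pow_mem (Algebra.subset_adjoin rfl) e)
      (Submodule.mem_map_of_mem hw)
  have hdim : finrank F W ≤ powDim F c j := by
    rw [LinearEquiv.finrank_eq (Submodule.equivMapOfInjective θ hθ W)]
    exact (Submodule.finrank_mono (Submodule.map_comap_le _ _)).trans
      (h.finrank_range_evalAt_le _ _)
  have hle : j * finrank F W ≤ finrank F X := by
    rw [hX]
    exact (Nat.mul_le_mul_left j hdim).trans (Nat.le_of_dvd hm hj)
  have htop : ⨆ i : Fin j, W.map (f ^ (i : ℕ)) = ⊤ := by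
    refine (hirr _ (iSup_translates_map_le hf hWf)).resolve_left fun h0 => ?_
    have h1 : W.map (f ^ 0) ≤ ⊥ := h0 ▸ le_iSup (fun i : Fin j => W.map (f ^ (i : ℕ))) ⟨0, hjpos⟩
    rw [pow_zero, Module.End.one_eq_id, Submodule.map_id] at h1
    exact hu (h1 huW)
  refine ⟨fun k : Fin j => W.map (f ^ (k : ℕ)), fun k hk => ?_, isInternal_translates htop hle,
    permutes_translates hf hWf⟩
  have hinj : Function.Injective (f ^ (k : ℕ) : End F X) := by
    rw [Module.End.coe_pow]; exact hf.iterate _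
  have h1 : (f ^ (k : ℕ)) u ∈ W.map (f ^ (k : ℕ)) := Submodule.mem_map_of_mem huW
  have h2 : (f ^ (k : ℕ)) u = 0 := by
    have h3 : W.map (f ^ (k : ℕ)) = ⊥ := hk
    rwa [h3, Submodule.mem_bot] at h1
  exact hu (hinj (h2.trans (map_zero _).symm))

/-- `V` is the direct sum of two isomorphic `c`-invariant subspaces of dimension `m`. -/
lemma exists_decomposition [Finite F] (h : QuatConfig m c a g) :
    ∃ (f : End F (Fin m → F)) (θ : ((Fin m → F) × (Fin m → F)) ≃ₗ[F] V),
      ∀ u w, θ (f u, f w) = c (θ (u, w)) := by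
  have hfd := h.finiteDimensional
  let L := Algebra.adjoin F {c ^ 1}
  have hL : IsField L := h.isField_of_le_centr (h.adjoin_le_centr 1)
  let : Field L := hL.toField
  have hLdim : finrank F L = m := h.powDim_one
  -- Over the field `L = F[c]` the space is a plane; each vector of an `L`-basis spans a copy of
  -- `L`, on which `c` acts by multiplication.
  have hV : finrank L V = 2 := by
    have h1 := Module.finrank_mul_finrank F L V
    rw [hLdim, h.finrank_eq, mul_comm] at h1
    exact Nat.eq_of_mul_eq_mul_right h.odd_m.pos h1
  have : Module.Finite L V := Module.finite_of_finrank_pos (by omega)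
  let b : Basis (Fin 2) L V := Module.finBasisOfFinrankEq L V hV
  let e : (Fin m → F) ≃ₗ[F] L := LinearEquiv.ofFinrankEq _ _ (by simp [hLdim])
  let C : L := ⟨c ^ 1, Algebra.subset_adjoin rfl⟩
  let f : End F (Fin m → F) := e.symm.toLinearMap ∘ₗ LinearMap.mulLeft F C ∘ₗ e.toLinearMap
  have hef : ∀ u, e (f u) = C * e u := fun u => by simp [f]
  let θ : ((Fin m → F) × (Fin m → F)) →ₗ[F] V :=
    (evalAt L (b 0) ∘ₗ e.toLinearMap).coprod (evalAt L (b 1) ∘ₗ e.toLinearMap)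
  have hθ : ∀ u w, θ (u, w) = e u • b 0 + e w • b 1 := fun u w => rfl
  have hinj : Function.Injective θ := by
    rw [injective_iff_map_eq_zero]
    rintro ⟨u, w⟩ h0
    rw [hθ] at h0
    have hind := Fintype.linearIndependent_iff.1 b.linearIndependent ![e u, e w]
      (by simpa [Fin.sum_univ_two] using h0)
    have h1 : e u = 0 := hind 0
    have h2 : e w = 0 := hind 1
    rw [e.map_eq_zero_iff] at h1 h2
    rw [h1, h2]; rfl
  refine ⟨f, LinearEquiv.ofInjectiveOfFinrankEq θ hinj (by simp [h.finrank_eq, two_mul]), ?_⟩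
  intro u w
  have hc : ∀ x : V, c x = C • x := fun x => by
    change c x = (c ^ 1) x
    rw [pow_one]
  change θ (f u, f w) = c (θ (u, w))
  rw [hθ, hθ, hc, hef, hef, smul_add, mul_smul, mul_smul]

end QuatConfig

end LinGroup

namespace LinGroup

open Module

/-! ### Matrices acting on row vectors, and passage to generators. -/

section RowAction

variable {F : Type*} [Field F] {n : ℕ}

/-- The action of a matrix on row vectors. -/
def rowAction (h : GL (Fin n) F) : End F (Fin n → F) :=
  Matrix.vecMulLinear (h : Matrix (Fin n) (Fin n) F)

lemma rowAction_apply (h : GL (Fin n) F) (v : Fin n → F) :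
    rowAction h v = Matrix.vecMul v (h : Matrix (Fin n) (Fin n) F) := rfl

lemma translate_eq_map (W : Submodule F (Fin n → F)) (h : GL (Fin n) F) :
    translate W h = W.map (rowAction h) := rfl

/-- The right action reverses products, which decides the side of each factor when group relations
are translated. -/
lemma rowAction_mul (x y : GL (Fin n) F) : rowAction (x * y) = rowAction y * rowAction x := by
  refine LinearMap.ext fun v => ?_
  simp [rowAction, Matrix.vecMul_vecMul]

lemma rowAction_one : rowAction (1 : GL (Fin n) F) = 1 := by
  refine LinearMap.ext fun v => ?_
  simp [rowAction]

lemma rowAction_neg (x : GL (Fin n) F) : rowAction (-x) = -rowAction x := by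
  refine LinearMap.ext fun v => ?_
  simp [rowAction]

lemma rowAction_pow (x : GL (Fin n) F) (k : ℕ) : rowAction (x ^ k) = rowAction x ^ k := by
  induction k with
  | zero => simp [rowAction_one]
  | succ k ih => rw [pow_succ', rowAction_mul, ih, pow_succ]

lemma rowAction_inj {x y : GL (Fin n) F} : rowAction x = rowAction y ↔ x = y := by
  refine ⟨fun h => Units.ext ?_, fun h => h ▸ rfl⟩
  ext i j
  have := congrFun (LinearMap.congr_fun h (Pi.single i 1)) j
  simpa [rowAction] using this

lemma rowAction_commute {x y : GL (Fin n) F} :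
    Commute (rowAction x) (rowAction y) ↔ Commute x y := by
  rw [Commute, SemiconjBy, ← rowAction_mul, ← rowAction_mul, rowAction_inj]
  exact eq_comm

lemma rowAction_injective (x : GL (Fin n) F) : Function.Injective (rowAction x) := by
  have h : rowAction x⁻¹ * rowAction x = 1 := by
    rw [← rowAction_mul, mul_inv_cancel, rowAction_one]
  exact Function.LeftInverse.injective (g := rowAction x⁻¹) fun v => LinearMap.congr_fun h v

lemma exists_rowAction_eq (e : (Fin n → F) ≃ₗ[F] (Fin n → F)) :
    ∃ x : GL (Fin n) F, rowAction x = e := by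
  have key : ∀ f : (Fin n → F) →ₗ[F] (Fin n → F),
      ∃ M : Matrix (Fin n) (Fin n) F, M.vecMulLinear = f := fun f =>
    ⟨LinearMap.toMatrixRight' f, Matrix.toLinearMapRight'.apply_symm_apply f⟩
  have hinj : ∀ M M' : Matrix (Fin n) (Fin n) F, M.vecMulLinear = M'.vecMulLinear → M = M' := by
    intro M M' h
    exact Matrix.toLinearMapRight'.injective h
  obtain ⟨M, hM⟩ := key e
  obtain ⟨M', hM'⟩ := key e.symm
  refine ⟨⟨M, M', hinj _ _ ?_, hinj _ _ ?_⟩, hM⟩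
  · refine LinearMap.ext fun v => ?_
    have h1 : Matrix.vecMul v M = e v := LinearMap.congr_fun hM v
    have h2 : Matrix.vecMul (e v) M' = e.symm (e v) := LinearMap.congr_fun hM' _
    simp [← Matrix.vecMul_vecMul, h1, h2]
  · refine LinearMap.ext fun v => ?_
    have h1 : Matrix.vecMul v M' = e.symm v := LinearMap.congr_fun hM' v
    have h2 : Matrix.vecMul (e.symm v) M = e (e.symm v) := LinearMap.congr_fun hM _
    simp [← Matrix.vecMul_vecMul, h1, h2]

/-- Properties closed under multiplication pass from generators to a finite group. -/
lemma forall_mem_closure_of_finite {Γ : Type*} [Group Γ] [Finite Γ] {s : Set Γ} {P : Γ → Prop}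
    (h1 : P 1) (hmul : ∀ x y, P x → P y → P (x * y)) (hs : ∀ x ∈ s, P x) :
    ∀ x ∈ Subgroup.closure s, P x := by
  intro x hx
  rw [← Subgroup.mem_toSubmonoid, Subgroup.closure_toSubmonoid_of_finite] at hx
  induction hx using Submonoid.closure_induction with
  | mem x hx => exact hs x hx
  | one => exact h1
  | mul x y _ _ hx hy => exact hmul x y hx hy

lemma isImprimitivitySystem_closure_iff [Finite F] {s : Set (GL (Fin n) F)} {k : ℕ}
    {U : Fin k → Submodule F (Fin n → F)} :
    IsImprimitivitySystem (Subgroup.closure s) U ↔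
      1 < k ∧ (∀ i, U i ≠ ⊥) ∧ DirectSum.IsInternal U ∧ ∀ h ∈ s, Permutes U (rowAction h) := by
  refine and_congr_right fun _ => and_congr_right fun _ => and_congr_right fun _ =>
    ⟨fun h x hx => h x (Subgroup.subset_closure hx), fun h => ?_⟩
  refine forall_mem_closure_of_finite (P := fun x => ∀ i, ∃ j, translate (U i) x = U j)
    (fun i => ⟨i, ?_⟩) (fun x y hx hy i => ?_) h
  · rw [translate_eq_map, rowAction_one, Module.End.one_eq_id, Submodule.map_id]
  · obtain ⟨j, hj⟩ := hx i
    obtain ⟨l, hl⟩ := hy j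
    refine ⟨l, ?_⟩
    rw [translate_eq_map] at *
    rw [rowAction_mul, Module.End.mul_eq_comp, Submodule.map_comp, hj, hl]

lemma isIrreducible_closure_iff [Finite F] {s : Set (GL (Fin n) F)} :
    IsIrreducible (Subgroup.closure s) ↔ 0 < n ∧ ∀ W : Submodule F (Fin n → F),
      (∀ h ∈ s, W.map (rowAction h) ≤ W) → W = ⊥ ∨ W = ⊤ := by
  refine and_congr_right fun _ => forall_congr' fun W => imp_congr_left
    ⟨fun h x hx => h x (Subgroup.subset_closure hx), fun h => ?_⟩
  refine forall_mem_closure_of_finite (P := fun x => translate W x ≤ W) ?_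
    (fun x y hx hy => ?_) h
  · rw [translate_eq_map, rowAction_one, Module.End.one_eq_id, Submodule.map_id]
  · rw [translate_eq_map] at *
    rw [rowAction_mul, Module.End.mul_eq_comp, Submodule.map_comp]
    exact (Submodule.map_mono hx).trans hy

/-- Row vectors of length `2m` as pairs of row vectors of length `m`. -/
def splitRow (F : Type*) [Field F] (m : ℕ) :
    (Fin (2 * m) → F) ≃ₗ[F] (Fin m → F) × (Fin m → F) :=
  (LinearEquiv.funCongrLeft F F (finSumFinEquiv.trans (finCongr (two_mul m).symm))).trans
    (LinearEquiv.sumArrowLequivProdArrow (Fin m) (Fin m) F F)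

lemma splitRow_diagPair {m : ℕ} (x : GL (Fin m) F) (v : Fin (2 * m) → F) :
    splitRow F m (rowAction (diagPair x) v) =
      (rowAction x (splitRow F m v).1, rowAction x (splitRow F m v).2) := by
  set e : Fin m ⊕ Fin m ≃ Fin (2 * m) := finSumFinEquiv.trans (finCongr (two_mul m).symm) with he
  have h1 : (rowAction (diagPair x) v) ∘ e =
      Matrix.vecMul (v ∘ e) (Matrix.fromBlocks (x : Matrix (Fin m) (Fin m) F) 0 0 x) := by
    rw [rowAction_apply]
    change (Matrix.vecMul v (Matrix.reindex e e (Matrix.fromBlocks _ 0 0 _))) ∘ e = _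
    rw [Matrix.reindex_apply, Matrix.submatrix_vecMul_equiv]
    ext k
    simp
  have h2 : ∀ w : Fin (2 * m) → F, splitRow F m w = ((w ∘ e) ∘ Sum.inl, (w ∘ e) ∘ Sum.inr) :=
    fun w => rfl
  rw [h2, h2, h1, Matrix.vecMul_fromBlocks]
  ext k <;> simp [rowAction_apply]

end RowAction

/-! ### The 2-groups of the statement. -/

section TwoGroups

lemma two_zmod_ne_zero {n : ℕ} (hn : 2 < n) : (1 : ZMod n) ≠ -1 := by
  intro h
  have h2 : ((2 : ℕ) : ZMod n) = 0 := by
    push_cast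
    linear_combination h
  rw [ZMod.natCast_eq_zero_iff] at h2
  have := Nat.le_of_dvd (by norm_num) h2
  omega

lemma not_comm_of_mulEquiv {H K : Type*} [Group H] [Group K] (e : H ≃* K) {x y : K}
    (h : x * y ≠ y * x) : ¬ ∀ x y : H, x * y = y * x := by
  intro hc
  apply h
  have := congrArg e (hc (e.symm x) (e.symm y))
  simpa using this

/-- All that the main equivalence takes from the classification of `G₂` is 2-power order and
noncommutativity. -/
lemma card_and_not_comm {H : Type*} [Group H]
    (hH : IsGenQuaternionTwoGroup H ∨ IsDihedralTwoGroup H ∨ IsSemidihedralTwoGroup H) :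
    (∃ k, Nat.card H = 2 ^ k) ∧ ¬ ∀ x y : H, x * y = y * x := by
  rcases hH with ⟨k, hk, ⟨e⟩⟩ | ⟨k, hk, ⟨e⟩⟩ | ⟨k, hk, x, y, hx, hy, hxy, hcard, -⟩
  · refine ⟨⟨k + 2, ?_⟩, not_comm_of_mulEquiv e (x := .a 1) (y := .xa 0) ?_⟩
    · have : NeZero (2 ^ k) := ⟨by positivity⟩
      rw [Nat.card_congr e.toEquiv, Nat.card_eq_fintype_card, QuaternionGroup.card]
      ring
    · rw [QuaternionGroup.a_mul_xa, QuaternionGroup.xa_mul_a, zero_sub, zero_add, ne_eq,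
        QuaternionGroup.xa.injEq]
      refine (two_zmod_ne_zero ?_).symm
      have := Nat.pow_le_pow_right (n := 2) (by norm_num) hk
      omega
  · refine ⟨⟨k + 1, ?_⟩, not_comm_of_mulEquiv e (x := .r 1) (y := .sr 0) ?_⟩
    · rw [Nat.card_congr e.toEquiv, DihedralGroup.nat_card]
      ring
    · rw [DihedralGroup.r_mul_sr, DihedralGroup.sr_mul_r, zero_sub, zero_add, ne_eq,
        DihedralGroup.sr.injEq]
      refine (two_zmod_ne_zero ?_).symm
      have := Nat.pow_le_pow_right (n := 2) (by norm_num) hk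
      omega
  · refine ⟨⟨k + 1, hcard⟩, fun hc => ?_⟩
    rw [hc y x, mul_inv_cancel_right] at hxy
    obtain ⟨l, rfl⟩ : ∃ l, k = l + 3 := ⟨k - 3, by omega⟩
    -- If `x` and `y` commuted, these two distinct exponents below the order of `x` would give the
    -- same power.
    have h1 : x ^ (2 ^ (l + 2) - 1) = x ^ 1 := by rw [pow_one]; exact hxy.symm
    rw [pow_inj_mod, hx, Nat.mod_eq_of_lt, Nat.mod_eq_of_lt] at h1
    · rw [pow_add] at h1
      have := Nat.one_le_two_pow (n := l)
      omega
    · exact Nat.one_lt_two_pow (by omega)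
    · have := Nat.pow_lt_pow_right (a := 2) (by norm_num) (show l + 2 < l + 3 by omega)
      change 2 ^ (l + 2) - 1 < _
      omega

/-- A group of order `8` generated by `a`, `g` with `a ^ 2 = g ^ 2` and
`g` inverting `a`, is the quaternion group. -/
lemma nonempty_mulEquiv_quaternionGroup {Γ : Type*} [Group Γ] {H : Subgroup Γ} {a g : Γ}
    (hH : H = Subgroup.closure {a, g}) (hcard : Nat.card H = 8) (ha : a ^ 4 = 1)
    (hg : g ^ 2 = a ^ 2) (hag : a * g = g * a⁻¹) : Nonempty (H ≃* QuaternionGroup 2) := by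
  -- As `a^4 = 1`, powers of `a` make sense for exponents modulo 4, which is how `QuaternionGroup 2`
  -- indexes its elements. The homomorphism `φ` sends `a i` to `a^i` and `xa i` to `g a^i`.
  let ε : ZMod (2 * 2) →+ Additive Γ :=
    ZMod.lift (2 * 2) ⟨zmultiplesHom _ (Additive.ofMul a), by
      change Additive.ofMul (a ^ (4 : ℤ)) = 0
      rw [show (4 : ℤ) = ((4 : ℕ) : ℤ) by norm_num, zpow_natCast, ha]; rfl⟩
  let E : ZMod (2 * 2) → Γ := fun i => (ε i).toMul
  have hE : ∀ z : ℤ, E z = a ^ z := fun z => by simp [E, ε]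
  have hadd : ∀ i j, E (i + j) = E i * E j := fun i j => by simp [E]
  have h0 : E 0 = 1 := by simp [E]
  have hEg : ∀ i, E i * g = g * E (-i) := by
    intro i
    obtain ⟨z, rfl⟩ := ZMod.intCast_surjective i
    have h1 : SemiconjBy g a⁻¹ a := hag.symm
    have h2 := h1.zpow_right z
    rw [← Int.cast_neg, hE, hE, zpow_neg, ← inv_zpow]
    exact h2.eq.symm
  have hE2 : E 2 = g * g := by
    have := hE 2
    push_cast at this
    rw [this, ← sq, hg]
    exact zpow_natCast a 2
  let φ : QuaternionGroup 2 →* Γ := MonoidHom.mk'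
    (fun x => match x with
      | .a i => E i
      | .xa i => g * E i) (by
      rintro (i | i) (j | j)
      · rw [QuaternionGroup.a_mul_a]; exact hadd i j
      · rw [QuaternionGroup.a_mul_xa]
        change g * E (j - i) = E i * (g * E j)
        rw [← mul_assoc, hEg, mul_assoc, ← hadd]
        congr 2; ring
      · rw [QuaternionGroup.xa_mul_a]
        change g * E (i + j) = g * E i * E j
        rw [hadd, mul_assoc]
      · rw [QuaternionGroup.xa_mul_xa]
        change E (((2 : ℕ) : ZMod (2 * 2)) + j - i) = g * E i * (g * E j)
        rw [mul_assoc, ← mul_assoc (E i), hEg, mul_assoc, ← hadd, ← mul_assoc, ← hE2, ← hadd]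
        congr 1; push_cast; ring)
  have hrange : ∀ x : H, (x : Γ) ∈ φ.range := by
    have : H ≤ φ.range := by
      rw [hH, Subgroup.closure_le, Set.insert_subset_iff, Set.singleton_subset_iff]
      constructor
      · refine ⟨.a 1, ?_⟩
        change E 1 = _
        have := hE 1
        simpa using this
      · refine ⟨.xa 0, ?_⟩
        change g * E 0 = g
        rw [h0, mul_one]
    exact fun x => this x.2
  have hle : H ≤ φ.range := fun x hx => hrange ⟨x, hx⟩
  have hc8 : Nat.card (QuaternionGroup 2) = 8 := by
    rw [Nat.card_eq_fintype_card, QuaternionGroup.card]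
  have hrc : Nat.card φ.range ≤ 8 := by
    rw [← hc8]
    exact Nat.card_le_card_of_surjective _ φ.rangeRestrict_surjective
  have hfin : Finite φ.range := Finite.of_surjective _ φ.rangeRestrict_surjective
  -- Counting replaces a check of injectivity: `H` has order 8 and lies in the image of a group of
  -- order 8.
  have heq : H = φ.range := Subgroup.eq_of_le_of_card_ge hle (by omega)
  have hbij : Function.Bijective φ.rangeRestrict := by
    refine (Nat.bijective_iff_surjective_and_card _).2 ⟨φ.rangeRestrict_surjective, ?_⟩
    rw [hc8, ← heq, hcard]
  exact ⟨(MulEquiv.subgroupCongr heq).trans (MulEquiv.ofBijective _ hbij).symm⟩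

end TwoGroups

end LinGroup

namespace LinGroup

open Module

/-! ### From the matrix groups to operators and back. -/

/-- The relations of the statement in terms of the action on row vectors. -/
lemma relations_iff {F : Type*} [Field F] {n : ℕ} {a g : GL (Fin n) F} :
    (a ^ 2 = -1 ∧ g ^ 2 = -1 ∧ a⁻¹ * g⁻¹ * a * g = -1) ↔
      (rowAction a * rowAction a = -1 ∧ rowAction g * rowAction g = -1 ∧
        rowAction g * rowAction a = -(rowAction a * rowAction g)) := by
  have h1 : (-1 : End F (Fin n → F)) = rowAction (-1 : GL (Fin n) F) := by
    rw [rowAction_neg, rowAction_one]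
  rw [h1, ← rowAction_mul, ← rowAction_mul, ← rowAction_mul, ← rowAction_mul, ← rowAction_neg,
    rowAction_inj, rowAction_inj, rowAction_inj, sq, sq]
  refine and_congr_right fun _ => and_congr_right fun _ => ?_
  rw [mul_assoc, ← mul_inv_rev, inv_mul_eq_iff_eq_mul, mul_neg, mul_one]

/-- The generators of the group in the statement act as a `QuatConfig`. -/
lemma quatConfig_rowAction {F : Type*} [Field F] [Finite F] (hq : Nat.card F % 4 = 3)
    {m : ℕ} (hmodd : Odd m) {G₂ : Subgroup (GL (Fin (2 * m)) F)} {a g c : GL (Fin (2 * m)) F}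
    (hc : Odd (orderOf c))
    (hG₂ : IsGenQuaternionTwoGroup G₂ ∨ IsDihedralTwoGroup G₂ ∨ IsSemidihedralTwoGroup G₂)
    (hgen : G₂ = Subgroup.closure {a, g}) (hindex : (Subgroup.zpowers a).relIndex G₂ = 2)
    (ha : 4 ≤ orderOf a) (hac : Commute a c) (hgc : Commute g c)
    (hA : IsIrreducible (Subgroup.closure {c, a})) :
    QuatConfig m (rowAction c) (rowAction a) (rowAction g) := by
  obtain ⟨⟨k, hk⟩, hncomm⟩ := card_and_not_comm hG₂
  have haG : a ∈ G₂ := hgen ▸ Subgroup.subset_closure (by simp)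
  have hgG : g ∈ G₂ := hgen ▸ Subgroup.subset_closure (by simp)
  have hidx : ((Subgroup.zpowers a).subgroupOf G₂).index = 2 := hindex
  have hpow : ∀ y ∈ Subgroup.zpowers a, ∃ e : ℕ, a ^ e = y := fun y hy =>
    (Submonoid.mem_powers_iff y a).1 (mem_powers_iff_mem_zpowers.2 hy)
  have hnormal := Subgroup.normal_of_index_eq_two hidx
  refine ⟨hq, hmodd, by simp, rowAction_commute.2 hac, rowAction_commute.2 hgc,
    ⟨orderOf c, hc, by rw [← rowAction_pow, pow_orderOf_eq_one, rowAction_one]⟩, ?_, ?_, ?_, ?_, ?_⟩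
  · have h1 : orderOf a ∣ 2 ^ k := by
      have h2 := orderOf_dvd_natCard (⟨a, haG⟩ : G₂)
      rwa [hk, Subgroup.orderOf_mk] at h2
    obtain ⟨l, -, hl⟩ := (Nat.dvd_prime_pow Nat.prime_two).1 h1
    have hl2 : 2 ≤ l := by
      by_contra hlt
      have : l ≤ 1 := by omega
      have := Nat.pow_le_pow_right (n := 2) (by norm_num) this
      omega
    obtain ⟨s, rfl⟩ : ∃ s, l = s + 2 := ⟨l - 2, by omega⟩
    refine ⟨s, ?_, ?_⟩
    · rw [← rowAction_pow, ← hl, pow_orderOf_eq_one, rowAction_one]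
    · rw [← rowAction_pow, ← rowAction_one, ne_eq, rowAction_inj]
      intro h0
      have h3 := Nat.le_of_dvd (by positivity) (orderOf_dvd_of_pow_eq_one h0)
      rw [hl] at h3
      have := Nat.pow_lt_pow_right (a := 2) (by norm_num) (show s + 1 < s + 2 by omega)
      omega
  -- Conjugating by `g⁻¹` gives `a g = g a^e`, which the reversal of products turns into the
  -- required relation.
  · have h1 := hnormal.conj_mem ⟨a, haG⟩
      (Subgroup.mem_subgroupOf.2 (Subgroup.mem_zpowers a)) ⟨g⁻¹, inv_mem hgG⟩
    obtain ⟨e, he⟩ := hpow _ (Subgroup.mem_subgroupOf.1 h1)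
    refine ⟨e, ?_⟩
    rw [← rowAction_pow, ← rowAction_mul, ← rowAction_mul, he]
    simp [mul_assoc]
  · have h1 := Subgroup.sq_mem_of_index_two hidx ⟨g, hgG⟩
    obtain ⟨f, hf⟩ := hpow _ (Subgroup.mem_subgroupOf.1 h1)
    refine ⟨f, ?_⟩
    rw [← rowAction_pow, ← rowAction_mul, hf]
    simp [sq]
  · rw [rowAction_commute]
    intro hga
    apply hncomm
    have hcl : ∀ x ∈ ({a, g} : Set (GL (Fin (2 * m)) F)), ∀ y ∈ ({a, g} : Set (GL (Fin (2 * m)) F)),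
        x * y = y * x := by
      rintro x hx y hy
      simp only [Set.mem_insert_iff, Set.mem_singleton_iff] at hx hy
      rcases hx with hx | hx <;> rcases hy with hy | hy <;> rw [hx, hy]
      exacts [hga.eq.symm, hga.eq]
    have hcomm := Subgroup.isMulCommutative_closure hcl
    rw [← hgen] at hcomm
    intro x y
    exact hcomm.is_comm.comm x y
  · intro W hWc hWa
    refine (isIrreducible_closure_iff.1 hA).2 W ?_
    rintro x hx
    simp only [Set.mem_insert_iff, Set.mem_singleton_iff] at hx
    rcases hx with rfl | rfl
    exacts [hWc, hWa]

namespace QuatConfig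

variable {F : Type*} [Field F] [Finite F] {m : ℕ} {a g c : GL (Fin (2 * m)) F}

/-- If `⟨c, a, g⟩` has no system of imprimitivity, then `⟨c⟩` is conjugate to `⟨(x, x)⟩` with
`⟨x⟩` primitive. -/
lemma exists_conjugate_diagPair (h : QuatConfig m (rowAction c) (rowAction a) (rowAction g))
    (hprim : ∀ j, 1 < j → ¬ j * powDim F (rowAction c) j ∣ m) :
    ∃ x : GL (Fin m) F, IsPrimitive (Subgroup.zpowers x) ∧
      AreConjugate (Subgroup.zpowers c) (Subgroup.zpowers (diagPair x)) := by
  obtain ⟨f, θ, hθ⟩ := h.exists_decomposition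
  have hm := h.odd_m.pos
  have hfpow : ∀ j u, θ ((f ^ j) u, 0) = (rowAction c ^ j) (θ (u, 0)) := by
    intro j
    induction j with
    | zero => intro u; simp
    | succ j ih =>
      intro u
      rw [pow_succ, Module.End.mul_apply, ih, pow_succ, Module.End.mul_apply, ← hθ, map_zero]
  have hfN : ∃ N, Odd N ∧ f ^ N = 1 := by
    obtain ⟨N, hN, hc⟩ := h.c_pow
    refine ⟨N, hN, LinearMap.ext fun u => ?_⟩
    have h1 := hfpow N u
    rw [hc, Module.End.one_apply] at h1
    exact congrArg Prod.fst (θ.injective h1)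
  obtain ⟨N, hN, hfN⟩ := hfN
  have hfinj := injective_of_pow_eq_one hN.pos hfN
  obtain ⟨x, hx⟩ := exists_rowAction_eq (LinearEquiv.ofInjectiveEndo f hfinj)
  have hxf : rowAction x = f := by rw [hx]; rfl
  -- `t` is the change of basis from the standard splitting of rows to the decomposition of `V` into
  -- two copies of `F[c]`.
  obtain ⟨t, ht⟩ := exists_rowAction_eq ((splitRow F m).trans θ)
  have htv : ∀ v, rowAction t v = θ (splitRow F m v) := fun v => by rw [ht]; rfl
  have hconj : t * c * t⁻¹ = diagPair x := by
    rw [mul_inv_eq_iff_eq_mul, ← rowAction_inj, rowAction_mul, rowAction_mul]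
    refine LinearMap.ext fun v => ?_
    rw [Module.End.mul_apply, Module.End.mul_apply, htv, htv, splitRow_diagPair, hxf, hθ]
  let ψ : (Fin m → F) →ₗ[F] (Fin (2 * m) → F) := θ.toLinearMap ∘ₗ LinearMap.inl F _ _
  have hψ : Function.Injective ψ := fun u w huw => congrArg Prod.fst (θ.injective huw)
  -- An `f^j`-invariant subspace embeds through the first summand as a `c^j`-invariant subspace of
  -- `V`, so it obeys the same divisibility.
  have hd : ∀ j (W : Submodule F (Fin m → F)), W.map (f ^ j) ≤ W →
      powDim F (rowAction c) j ∣ finrank F W := by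
    intro j W hW
    rw [LinearEquiv.finrank_eq (Submodule.equivMapOfInjective ψ hψ W)]
    apply h.powDim_dvd
    rintro _ ⟨_, ⟨w, hw, rfl⟩, rfl⟩
    exact ⟨(f ^ j) w, hW (Submodule.mem_map_of_mem hw), hfpow j w⟩
  refine ⟨x, ⟨?_, ?_⟩, t, ?_⟩
  · rw [Subgroup.zpowers_eq_closure, isIrreducible_closure_iff]
    refine ⟨hm, fun W hW => ?_⟩
    have h1 : W.map f ≤ W := hxf ▸ hW x rfl
    have h2 := hd 1 W (by rwa [pow_one])
    rw [h.powDim_one] at h2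
    rcases Nat.eq_zero_or_pos (finrank F W) with h0 | h0
    · exact Or.inl (Submodule.finrank_eq_zero.1 h0)
    · right
      apply Submodule.eq_top_of_finrank_eq
      refine le_antisymm (Submodule.finrank_le _) ?_
      rw [Module.finrank_fin_fun]
      exact Nat.le_of_dvd h0 h2
  · rintro k ⟨U, hU⟩
    rw [Subgroup.zpowers_eq_closure, isImprimitivitySystem_closure_iff] at hU
    obtain ⟨hk, hne, hint, hp⟩ := hU
    have := (h.blocks_invariant hint hne hN hfN (hxf ▸ hp x rfl) (Or.inl rfl) (by simp) hd hprim).2.2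
    rw [Fintype.card_fin] at this
    omega
  · rw [MonoidHom.map_zpowers, ← hconj]
    rfl

/-- Conversely, if `⟨c⟩` is conjugate to `⟨(x, x)⟩` with `⟨x⟩` primitive, no proper power of `c`
yields a decomposition. -/
lemma not_dvd_of_conjugate_diagPair (h : QuatConfig m (rowAction c) (rowAction a) (rowAction g))
    {x : GL (Fin m) F} (hx : IsPrimitive (Subgroup.zpowers x))
    (hconj : AreConjugate (Subgroup.zpowers c) (Subgroup.zpowers (diagPair x))) (j : ℕ)
    (hj : 1 < j) : ¬ j * powDim F (rowAction c) j ∣ m := by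
  intro hdvd
  obtain ⟨hirr, hprim⟩ := hx
  rw [Subgroup.zpowers_eq_closure, isIrreducible_closure_iff] at hirr
  obtain ⟨t, ht⟩ := hconj
  -- Conjugacy is between cyclic groups, not generators, so `(x, x)` corresponds only to some power
  -- `c^e`.
  have hmem : diagPair x ∈ (Subgroup.zpowers c).map (MulAut.conj t).toMonoidHom :=
    ht ▸ Subgroup.mem_zpowers _
  obtain ⟨y, hy, hty⟩ := hmem
  obtain ⟨e, rfl⟩ := (Submonoid.mem_powers_iff y c).1 (mem_powers_iff_mem_zpowers.2 hy)
  have htc : diagPair x * t = t * c ^ e := by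
    rw [← hty]
    change t * c ^ e * t⁻¹ * t = _
    rw [inv_mul_cancel_right]
  let θ : (Fin m → F) →ₗ[F] (Fin (2 * m) → F) :=
    rowAction t ∘ₗ (splitRow F m).symm.toLinearMap ∘ₗ LinearMap.inl F _ _
  have hθ : ∀ u, θ u = rowAction t ((splitRow F m).symm (u, 0)) := fun u => rfl
  have hθinj : Function.Injective θ := fun u w huw =>
    congrArg Prod.fst ((splitRow F m).symm.injective (rowAction_injective t huw))
  have hint : ∀ u, θ (rowAction x u) = (rowAction c ^ e) (θ u) := by
    intro u
    rw [hθ, hθ, ← rowAction_pow, ← Module.End.mul_apply, ← rowAction_mul, ← htc, rowAction_mul,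
      Module.End.mul_apply]
    congr 1
    rw [LinearEquiv.symm_apply_eq, splitRow_diagPair]
    simp
  obtain ⟨W, hne, hW, hp⟩ := h.exists_system_of_intertwining θ hθinj (rowAction_injective x) hint
    (by simp) (fun W hW => hirr.2 W (by rintro _ rfl; exact hW)) hdvd
  refine hprim j ⟨W, ?_⟩
  rw [Subgroup.zpowers_eq_closure, isImprimitivitySystem_closure_iff]
  exact ⟨hj, hne, hW, by rintro _ rfl; exact hp⟩

end QuatConfig

end LinGroup

/-! ### The theorem. -/

open LinGroup in
theorem theorem5p5 {F : Type*} [Field F] [Finite F] (hq : Nat.card F % 4 = 3)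
    (m : ℕ) (hm : 1 < m) (hmodd : Odd m)
    (G G₂ C A : Subgroup (GL (Fin (2 * m)) F)) (a g c : GL (Fin (2 * m)) F)
    -- `C = ⟨c⟩` is cyclic of odd order
    (hC : C = Subgroup.zpowers c) (hc : Odd (orderOf c))
    -- `G₂` is generalised quaternion, dihedral or semidihedral
    (hG₂ : LinGroup.IsGenQuaternionTwoGroup G₂ ∨ LinGroup.IsDihedralTwoGroup G₂ ∨
      LinGroup.IsSemidihedralTwoGroup G₂)
    -- `G₂ = ⟨a, g⟩` with `⟨a⟩` of index 2 and order at least 4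
    (hgen : G₂ = Subgroup.closure {a, g}) (hindex : (Subgroup.zpowers a).relIndex G₂ = 2)
    (ha : 4 ≤ orderOf a)
    -- `G` is the internal direct product of `G₂` and `C`
    (hcomm : ∀ x ∈ G₂, ∀ y ∈ C, x * y = y * x) (hdisj : G₂ ⊓ C = ⊥) (hG : G = G₂ ⊔ C)
    -- `A = ⟨c, a⟩` is irreducible
    (hA : A = Subgroup.closure {c, a}) (hAirr : LinGroup.IsIrreducible A) :
    ((LinGroup.IsPrimitive G ∧ ¬ LinGroup.IsPrimitive A) ↔
      (LinGroup.HasImprimitivitySystem A 2 ∧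
        (∃ x : GL (Fin m) F, LinGroup.IsPrimitive (Subgroup.zpowers x) ∧
          LinGroup.AreConjugate C (Subgroup.zpowers (LinGroup.diagPair x))) ∧
        (a ^ 2 = -1 ∧ g ^ 2 = -1 ∧ a⁻¹ * g⁻¹ * a * g = -1))) ∧
    -- the three relations say in particular that `G₂` is the quaternion group of order 8
    ((a ^ 2 = -1 ∧ g ^ 2 = -1 ∧ a⁻¹ * g⁻¹ * a * g = -1) → Nonempty (G₂ ≃* QuaternionGroup 2)) := by
  have haG : a ∈ G₂ := hgen ▸ Subgroup.subset_closure (by simp)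
  have hgG : g ∈ G₂ := hgen ▸ Subgroup.subset_closure (by simp)
  have hcC : c ∈ C := hC ▸ Subgroup.mem_zpowers c
  have hcfg : QuatConfig m (rowAction c) (rowAction a) (rowAction g) :=
    quatConfig_rowAction hq hmodd hc hG₂ hgen hindex ha (hcomm a haG c hcC) (hcomm g hgG c hcC)
      (hA ▸ hAirr)
  have hGcl : G = Subgroup.closure ({a, g} ∪ {c}) := by
    rw [Subgroup.closure_union, ← Subgroup.zpowers_eq_closure, hG, hgen, hC]
  have hAG : A ≤ G := by
    rw [hA, hGcl]
    apply Subgroup.closure_mono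
    rintro x (rfl | rfl) <;> simp
  have hGirr : IsIrreducible G :=
    ⟨hAirr.1, fun W hW => hAirr.2 W fun x hx => hW x (hAG hx)⟩
  have hGsys : ∀ {k : ℕ} {U : Fin k → Submodule F (Fin (2 * m) → F)},
      IsImprimitivitySystem G U ↔ 1 < k ∧ (∀ i, U i ≠ ⊥) ∧ DirectSum.IsInternal U ∧
        Permutes U (rowAction c) ∧ Permutes U (rowAction a) ∧ Permutes U (rowAction g) := by
    intro k U
    rw [hGcl, isImprimitivitySystem_closure_iff]
    simp only [Set.union_singleton, Set.mem_insert_iff, Set.mem_singleton_iff, forall_eq_or_imp,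
      forall_eq]
  have hAsys : ∀ {k : ℕ} {U : Fin k → Submodule F (Fin (2 * m) → F)},
      IsImprimitivitySystem A U ↔ 1 < k ∧ (∀ i, U i ≠ ⊥) ∧ DirectSum.IsInternal U ∧
        Permutes U (rowAction c) ∧ Permutes U (rowAction a) := by
    intro k U
    rw [hA, isImprimitivitySystem_closure_iff]
    simp only [Set.mem_insert_iff, Set.mem_singleton_iff, forall_eq_or_imp, forall_eq]
  refine ⟨⟨?_, ?_⟩, ?_⟩
  · rintro ⟨⟨-, hGprim⟩, hAimp⟩
    -- Primitivity of `G` enters here, giving condition (*), and once more at the end to exclude `g²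
    -- = 1`.
    have hprim : ∀ j, 1 < j → ¬ j * QuatConfig.powDim F (rowAction c) j ∣ m := by
      intro j hj hdvd
      obtain ⟨W, hne, hW, hWc, hWa, hWg⟩ := hcfg.exists_system hdvd
      exact hGprim j ⟨W, hGsys.2 ⟨hj, hne, hW, hWc, hWa, hWg⟩⟩
    obtain ⟨k, U, hUsys⟩ : ∃ k, HasImprimitivitySystem A k := by
      by_contra hno
      exact hAimp ⟨hAirr, not_exists.1 hno⟩
    obtain ⟨hk, hne, hU, hUc, hUa⟩ := hAsys.1 hUsys
    obtain ⟨rfl, -, hdim⟩ := hcfg.two_blocks hk hU hne hUc hprim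
    obtain ⟨haa, hga⟩ := hcfg.relations_of_two_blocks hU hne hUa (hdim 0)
    refine ⟨⟨U, hUsys⟩, hC ▸ hcfg.exists_conjugate_diagPair hprim,
      relations_iff.2 ⟨haa, hcfg.g_sq_eq.resolve_left fun hgg => ?_, hga⟩⟩
    obtain ⟨W, hWne, hW, hWc, hWa, hWg⟩ := hcfg.exists_system_of_involution haa hga hgg
    exact hGprim 2 ⟨W, hGsys.2 ⟨one_lt_two, hWne, hW, hWc, hWa, hWg⟩⟩
  · rintro ⟨hA2, ⟨x, hx, hconj⟩, hrel⟩
    refine ⟨⟨hGirr, ?_⟩, fun hAprim => hAprim.2 2 hA2⟩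
    rintro k ⟨U, hU⟩
    obtain ⟨hk, hne, hint, hUc, hUa, hUg⟩ := hGsys.1 hU
    obtain ⟨haa, hgg, hga⟩ := relations_iff.1 hrel
    exact hcfg.not_permutes haa hgg hga
      (hcfg.not_dvd_of_conjugate_diagPair hx (hC ▸ hconj)) hk hint hne hUc hUa hUg
  · rintro ⟨haa, hgg, hag⟩
    have ha4 : a ^ 4 = 1 := by rw [show 4 = 2 * 2 by norm_num, pow_mul, haa, neg_one_sq]
    have hord : orderOf a = 4 :=
      le_antisymm (Nat.le_of_dvd (by norm_num) (orderOf_dvd_of_pow_eq_one ha4)) ha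
    have hcard : Nat.card G₂ = 8 := by
      have h1 := Subgroup.card_mul_index ((Subgroup.zpowers a).subgroupOf G₂)
      have h2 : ((Subgroup.zpowers a).subgroupOf G₂).index = 2 := hindex
      have hle : Subgroup.zpowers a ≤ G₂ := by rwa [Subgroup.zpowers_le]
      rw [h2, Nat.card_congr (Subgroup.subgroupOfEquivOfLe hle).toEquiv, Nat.card_zpowers,
        hord] at h1
      exact h1.symm
    refine nonempty_mulEquiv_quaternionGroup hgen hcard ha4 (hgg.trans haa.symm) ?_
    have hinv : a⁻¹ = -a := by
      rw [inv_eq_iff_mul_eq_one, mul_neg, ← sq, haa, neg_neg]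
    rw [mul_assoc, ← mul_inv_rev, inv_mul_eq_iff_eq_mul] at hag
    rw [hag, hinv]
    simp
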